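/- Fix a real number $\beta>1$, let $T_\beta\colon[0,1]\to[0,1]$ be given by $T_\beta(x)=\beta x \bmod 1$ (the fractional part of $\beta x$), and for $x\in[0,1]$ let $d_i(x)=\lfloor \beta\,T_\beta^{i-1}(x)\rfloor$, $i\ge 1$, be the digits of the (greedy) $\beta$-expansion of $x$. A point $x\in[0,1]$ \emph{generates} a Borel probability measure $\mu$ on $[0,1]$ if for every interval $J\subseteq[0,1]$ whose boundary relative to $[0,1]$ satisfies $\mu(\partial J)=0$ we have $$\lim_{N\to\infty}\frac1N\bigl|\{0\le n<N: T_\beta^n(x)\in J\}\bigr|=\mu(J).$$ The point $x$ has an \emph{irregular} $\beta$-expansion if there is a finite nonempty block $w=w_1\ldots w_k$ of nonnegative integers such that the limit $$\lim_{N\to\infty}\frac1N\bigl|\{1\le \ell\le N: d_{\ell+j-1}(x)=w_j\text{ for }1\le j\le k\}\bigr|$$ does not exist. A subset of a topological space is $\boldsymbol{\Sigma}^0_1$ if it is open, $\boldsymbol{\Pi}^0_n$ if its complement is $\boldsymbol{\Sigma}^0_n$, and, for $n\ge2$, $\boldsymbol{\Sigma}^0_n$ if it is a countable union of sets each of which is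 $\boldsymbol{\Pi}^0_m$ for some $1\le m<n$. A set is called $\boldsymbol{\Pi}^0_3$-complete if it is $\boldsymbol{\Pi}^0_3$ but not $\boldsymbol{\Sigma}^0_3$, and $\boldsymbol{\Sigma}^0_3$-complete if it is $\boldsymbol{\Sigma}^0_3$ but not $\boldsymbol{\Pi}^0_3$. \textbf{Theorem.} Let $\beta>1$. (1) For every $T_\beta$-invariant Borel probability measure $\mu$ on $[0,1]$, the set of all $x\in[0,1]$ that generate $\mu$ is a $\boldsymbol{\Pi}^0_3$-complete subset of $[0,1]$. (2) The set of all $x\in[0,1]$ with irregular $\beta$-expansion is a $\boldsymbol{\Sigma}^0_3$-complete subset of $[0,1]$. -/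

import Mathlib

namespace BetaExpansion

/-- The additive classes of the (finite part of the) Borel hierarchy of a topological space.
`IsSigma n A` says that `A` is a `Σ⁰ₙ` set: `Σ⁰₁` sets are the open sets, and for `n ≥ 2` the
`Σ⁰ₙ` sets are the unions `⋃ₖ Aₖ`, where each `Aₖ` is a `Π⁰ₘ` set for some `1 ≤ m < n`
depending on `k`, that is, the complement of a `Σ⁰ₘ` set. There are no `Σ⁰₀` sets. -/
inductive IsSigma {X : Type*} [TopologicalSpace X] : ℕ → Set X → Prop
  | of_isOpen (A : Set X) (hA : IsOpen A) : IsSigma 1 A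
  | iUnion_compl (n : ℕ) (m : ℕ → ℕ) (B : ℕ → Set X) (hn : 2 ≤ n) (hm : ∀ k, m k < n)
      (hB : ∀ k, IsSigma (m k) (B k)) : IsSigma n (⋃ k, (B k)ᶜ)

/-- `Π⁰ₙ` sets: the complements of the `Σ⁰ₙ` sets. -/
def IsPi {X : Type*} [TopologicalSpace X] (n : ℕ) (A : Set X) : Prop :=
  IsSigma n Aᶜ

/-- `A` is `Σ⁰ₙ`-complete: it is a `Σ⁰ₙ` set, but not a `Π⁰ₙ` set. -/
def IsSigmaComplete {X : Type*} [TopologicalSpace X] (n : ℕ) (A : Set X) : Prop :=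
  IsSigma n A ∧ ¬ IsPi n A

/-- `A` is `Π⁰ₙ`-complete: it is a `Π⁰ₙ` set, but not a `Σ⁰ₙ` set. -/
def IsPiComplete {X : Type*} [TopologicalSpace X] (n : ℕ) (A : Set X) : Prop :=
  IsPi n A ∧ ¬ IsSigma n A

/-- The set `S` of natural numbers has frequency (asymptotic density) `a`:
`|{n < N : n ∈ S}| / N → a` as `N → ∞`. -/
def HasFrequency (S : Set ℕ) (a : ℝ) : Prop :=
  Filter.Tendsto (fun N : ℕ => ({n : ℕ | n < N ∧ n ∈ S}.ncard : ℝ) / (N : ℝ))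
    Filter.atTop (nhds a)

/-- The map `T_β(x) = βx mod 1` of the unit interval `[0,1]` into itself. -/
noncomputable def betaMap (β : ℝ) (x : unitInterval) : unitInterval :=
  ⟨Int.fract (β * (x : ℝ)), Int.fract_nonneg _, (Int.fract_lt_one _).le⟩

/-- The point `x` generates `μ` under `T`: the orbit `(Tⁿ x)` is uniformly distributed with
respect to `μ`, that is, it visits every interval `J ⊆ [0,1]` whose boundary in `[0,1]` is
`μ`-null with frequency `μ(J)`. The intervals are the order-connected sets. -/
def Generates (T : unitInterval → unitInterval) (μ : MeasureTheory.Measure unitInterval)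
    (x : unitInterval) : Prop :=
  ∀ J : Set unitInterval, J.OrdConnected → μ (frontier J) = 0 →
    HasFrequency {n : ℕ | T^[n] x ∈ J} (μ J).toReal

/-- The digits `⌊β T_β^i(x)⌋`, `i ≥ 0`, of the (greedy) `β`-expansion of `x ∈ [0,1]`; for `β > 1`
they are elements of `{0, …, ⌊β⌋}`. -/
noncomputable def betaDigit (β : ℝ) (x : unitInterval) (i : ℕ) : ℕ :=
  ⌊β * (((betaMap β)^[i] x : unitInterval) : ℝ)⌋₊

/-- The positions at which the block `w` appears in the sequence `s`. -/
def occurrences (s : ℕ → ℕ) {k : ℕ} (w : Fin k → ℕ) : Set ℕ :=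
  {l : ℕ | ∀ i : Fin k, s (l + i) = w i}

/-- The sequence `s` is irregular: for some finite nonempty block `w`, the set of positions at
which `w` appears in `s` does not have a frequency. -/
def IsIrregular (s : ℕ → ℕ) : Prop :=
  ∃ (k : ℕ) (w : Fin k → ℕ), 1 ≤ k ∧ ¬ ∃ a : ℝ, HasFrequency (occurrences s w) a

end BetaExpansion

open Filter Topology Set Asymptotics MeasureTheory

/-! The sequences `α : ℕ → ℕ` tending to infinity form a set that is not `Σ⁰₃`, by a Baire category
argument (`not_isSigma_three_tendsto_atTop`). Both lower bounds pull this back along a continuous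
map `g` from Baire space to `[0,1]` (`exists_continuous_reduction`): if `α → ∞`, the orbit of `g α`
has the moments of `μ`; otherwise its Birkhoff averages diverge.

The orbit of `g α` follows prescribed segments of lengths 1, 2, 3, …. Lowering the last nonzero
digit of a word makes it free to be followed by any expansion, at a total orbit error bounded
independently of its length (`exists_full_word`). After `j` segments the error is `O(j)`, against a
time of order `j²`, so averages do not see it. A greedy choice provides segments with the moments of
`μ` (`exists_segments`); ergodicity plays no role. In the `b`-th dyadic block of segments, an
initial proportion of about `1 / (α b + 3)` is replaced by orbit segments of a point `z` with a
different mean. This is negligible when `α → ∞`; if `α` is bounded along a subsequence, the averages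
oscillate.

By Weierstrass approximation, generating `μ` means convergence of all moments, which gives (1). For
(2), take `μ = δ₀`. Generic points of `δ₀` have long runs of zero digits most of the time, hence are
regular, while regularity makes the averages of the digits, and so of the orbit, converge.

The upper bounds hold because the iterates of the map are continuous off a countable set, so that
both conditions have the form `∃ ∀ ∃` over sets that are open off it (`isSigma_three_setOf`). -/

/-! ### `Σ⁰₃` sets, and a set that is not `Σ⁰₃` -/

theorem isSigma_three_iff {X : Type*} [TopologicalSpace X] [TopologicalSpace.MetrizableSpace X]
    {A : Set X} :
    BetaExpansion.IsSigma 3 A ↔ ∃ G : ℕ → Set X, (∀ k, IsGδ (G k)) ∧ A = ⋃ k, G k := by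
  let _ := TopologicalSpace.metrizableSpaceMetric X
  have isOpen_of_one : ∀ B : Set X, BetaExpansion.IsSigma 1 B → IsOpen B := by
    intro B hB
    cases hB with
    | of_isOpen _ h => exact h
    | iUnion_compl n m B hn => omega
  have not_zero : ∀ B : Set X, ¬ BetaExpansion.IsSigma 0 B := by
    intro B hB
    cases hB with
    | iUnion_compl n m B hn => omega
  -- Metrizability enters here: closed sets are `Gδ`, so `Π⁰₁` pieces can be treated like `Π⁰₂`
  -- pieces.
  have gdelta_one : ∀ B : Set X, BetaExpansion.IsSigma 1 B → IsGδ Bᶜ := fun B hB =>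
    (isOpen_of_one B hB).isClosed_compl.isGδ
  have gdelta_two : ∀ B : Set X, BetaExpansion.IsSigma 2 B → IsGδ Bᶜ := by
    intro B hB
    cases hB with
    | iUnion_compl n m C hn hm hC =>
      rw [compl_iUnion]
      refine IsGδ.iInter fun k => ?_
      rw [compl_compl]
      have h1 := hm k
      have h2 := hC k
      interval_cases h : m k
      · exact absurd h2 (not_zero _)
      · exact (isOpen_of_one _ h2).isGδ
  constructor
  · intro h
    cases h with
    | iUnion_compl n m B hn hm hB =>
      refine ⟨fun k => (B k)ᶜ, fun k => ?_, rfl⟩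
      have h1 := hm k
      have h2 := hB k
      interval_cases h : m k
      · exact absurd h2 (not_zero _)
      · exact gdelta_one _ h2
      · exact gdelta_two _ h2
  · rintro ⟨G, hG, rfl⟩
    have : ∀ k, BetaExpansion.IsSigma 2 (G k)ᶜ := by
      intro k
      obtain ⟨U, hU, h⟩ := (hG k).eq_iInter_nat
      rw [h, compl_iInter]
      exact .iUnion_compl 2 (fun _ => 1) U le_rfl (fun _ => by norm_num)
        fun n => .of_isOpen _ (hU n)
    have h := BetaExpansion.IsSigma.iUnion_compl 3 (fun _ => 2) (fun k => (G k)ᶜ)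
      (by norm_num) (fun _ => by norm_num) this
    simpa using h

theorem isSigma_three_preimage {X Y : Type*} [TopologicalSpace X] [TopologicalSpace Y]
    [TopologicalSpace.MetrizableSpace X] [TopologicalSpace.MetrizableSpace Y]
    {A : Set Y} (hA : BetaExpansion.IsSigma 3 A) {g : X → Y} (hg : Continuous g) :
    BetaExpansion.IsSigma 3 (g ⁻¹' A) := by
  obtain ⟨G, hG, rfl⟩ := isSigma_three_iff.1 hA
  exact isSigma_three_iff.2 ⟨fun k => g ⁻¹' G k, fun k => (hG k).preimage hg, preimage_iUnion⟩

/-- The sets defined by an `∃ ∀ ∃` condition that is open off a countable set are `Σ⁰₃`. -/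
theorem isSigma_three_setOf {X ι κ η : Type*} [TopologicalSpace X]
    [TopologicalSpace.MetrizableSpace X] [Countable ι] [Countable κ] [Nonempty ι]
    {D : Set X} (hD : D.Countable) (U : ι → κ → η → Set X)
    (hU : ∀ p M N, ∀ x ∉ D, x ∈ U p M N → U p M N ∈ 𝓝 x) :
    BetaExpansion.IsSigma 3 {x | ∃ p, ∀ M, ∃ N, x ∈ U p M N} := by
  let _ := TopologicalSpace.metrizableSpaceMetric X
  rw [isSigma_three_iff]
  set R := {x | ∃ p, ∀ M, ∃ N, x ∈ U p M N} with hR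
  have hC : (R ∩ D).Countable := hD.mono inter_subset_right
  have : Countable ↥(R ∩ D) := hC
  -- Off `D` each `U p M N` may be replaced by its interior; the countably many points of `R` in `D`
  -- are added back as singletons.
  let G : ι ⊕ ↥(R ∩ D) → Set X := fun s => Sum.elim
    (fun p => (⋂ M, ⋃ N, interior (U p M N)) ∩ Dᶜ) (fun x => {(x : X)}) s
  have hG : ∀ s, IsGδ (G s) := by
    rintro (p | x)
    · exact (IsGδ.iInter fun M => (isOpen_iUnion fun N => isOpen_interior).isGδ).inter
        hD.isGδ_compl
    · exact isClosed_singleton.isGδ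
  obtain ⟨f, hf⟩ := exists_surjective_nat (ι ⊕ ↥(R ∩ D))
  refine ⟨fun k => G (f k), fun k => hG _, ?_⟩
  rw [hf.iUnion_comp G]
  ext x
  simp only [mem_iUnion, Sum.exists]
  constructor
  · intro hx
    by_cases hxD : x ∈ D
    · exact Or.inr ⟨⟨x, hx, hxD⟩, rfl⟩
    · obtain ⟨p, hp⟩ := hx
      refine Or.inl ⟨p, mem_iInter.2 fun M => ?_, hxD⟩
      obtain ⟨N, hN⟩ := hp M
      exact mem_iUnion.2 ⟨N, mem_interior_iff_mem_nhds.2 (hU p M N x hxD hN)⟩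
  · rintro (⟨p, hp, -⟩ | ⟨y, hy⟩)
    · refine ⟨p, fun M => ?_⟩
      obtain ⟨N, hN⟩ := mem_iUnion.1 (mem_iInter.1 hp M)
      exact ⟨N, interior_subset hN⟩
    · rw [show x = y from hy]
      exact y.2.1

/-- Baire category in the closed set `K` of sequences that agree with `s` below `L` and are at least
`k` afterwards. Those taking the value `k` infinitely often form a dense `Gδ` disjoint from `G`, so
`G` is not dense in `K`, and some basic open subset of `K` misses it. -/
theorem exists_extension_avoiding {G : Set (ℕ → ℕ)} (hG : IsGδ G)
    (hGC : ∀ a ∈ G, Tendsto a atTop atTop) (k : ℕ) (s : ℕ → ℕ) (L : ℕ) :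
    ∃ (s' : ℕ → ℕ) (L' : ℕ), L < L' ∧ (∀ i < L, s' i = s i) ∧ (∀ i, L ≤ i → k ≤ s' i) ∧
      ∀ a : ℕ → ℕ, (∀ i < L', a i = s' i) → (∀ i, L' ≤ i → k ≤ a i) → a ∉ G := by
  let K : Set (ℕ → ℕ) := {a | (∀ i < L, a i = s i) ∧ ∀ i, L ≤ i → k ≤ a i}
  have hK : IsClosed K := by
    have : K = (⋂ i, ⋂ (_ : i < L), {a | a i = s i}) ∩ ⋂ i, ⋂ (_ : L ≤ i), {a | k ≤ a i} := by
      ext a; simp [K]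
    rw [this]
    exact (isClosed_iInter fun i => isClosed_iInter fun _ =>
      isClosed_eq (continuous_apply i) continuous_const).inter
      (isClosed_iInter fun i => isClosed_iInter fun _ =>
      isClosed_le continuous_const (continuous_apply i))
  have : CompleteSpace K := hK.completeSpace_coe
  let G' : Set K := Subtype.val ⁻¹' G
  let H : Set K := ⋂ m : ℕ, ⋃ n : ℕ, ⋃ (_ : m ≤ n), {a : K | (a : ℕ → ℕ) n = k}
  have hopen : ∀ n, IsOpen {a : K | (a : ℕ → ℕ) n = k} := fun n => by
    have h : Continuous fun a : K => (a : ℕ → ℕ) n :=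
      (continuous_apply n).comp continuous_subtype_val
    exact (isOpen_discrete {k}).preimage h
  have hHG : IsGδ H := IsGδ.iInter fun m =>
    (isOpen_iUnion fun n => isOpen_iUnion fun _ => hopen n).isGδ
  have hHd : Dense H := by
    intro a
    let c : ℕ → K := fun B => ⟨fun i => if i < max B L then (a : ℕ → ℕ) i else k, by
      refine ⟨fun i hi => ?_, fun i hi => ?_⟩
      · simp only [lt_max_iff, hi, or_true, if_true]
        exact a.2.1 i hi
      · dsimp only
        split_ifs
        · exact a.2.2 i hi
        · exact le_rfl⟩
    have hc : Tendsto c atTop (𝓝 a) := by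
      rw [tendsto_subtype_rng, tendsto_pi_nhds]
      intro i
      refine tendsto_const_nhds.congr' ?_
      filter_upwards [eventually_gt_atTop i] with B hB
      simp [c, hB]
    refine mem_closure_of_tendsto hc (Eventually.of_forall fun B => ?_)
    simp only [H, mem_iInter, mem_iUnion]
    intro m
    refine ⟨max m (max B L), le_max_left _ _, ?_⟩
    simp [c]
  have hnd : ¬ Dense G' := by
    intro hd
    have hne : (univ : Set K).Nonempty := by
      refine ⟨⟨fun i => if i < L then s i else k, fun i hi => by simp [hi], fun i hi => ?_⟩,
        mem_univ _⟩
      simp [not_lt.2 hi]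
    obtain ⟨a, -, haG, haH⟩ := (Dense.inter_of_Gδ (hG.preimage continuous_subtype_val)
      hHG hd hHd).inter_open_nonempty univ isOpen_univ hne
    obtain ⟨m, hm⟩ := eventually_atTop.1 ((hGC _ haG).eventually_gt_atTop k)
    simp only [H, mem_iInter, mem_iUnion] at haH
    obtain ⟨n, hn, h⟩ := haH m
    exact absurd (hm n hn) (by rw [show (a : ℕ → ℕ) n = k from h]; exact lt_irrefl _)
  obtain ⟨a, ha⟩ := not_forall.1 hnd
  have hnh : ((closure G')ᶜ : Set K) ∈ 𝓝 a := isClosed_closure.isOpen_compl.mem_nhds ha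
  rw [nhds_subtype_eq_comap, mem_comap, nhds_pi] at hnh
  obtain ⟨V, hV, hVG⟩ := hnh
  obtain ⟨I, hI, t, ht, htV⟩ := Filter.mem_pi.1 hV
  obtain ⟨B, hB⟩ := hI.bddAbove
  refine ⟨a, max (B + 1) (L + 1), by omega, a.2.1, a.2.2, fun c hc hck hcG => ?_⟩
  have hcK : c ∈ K := by
    refine ⟨fun i hi => ?_, fun i hi => ?_⟩
    · rw [hc i (by omega)]; exact a.2.1 i hi
    · by_cases h : i < max (B + 1) (L + 1)
      · rw [hc i h]; exact a.2.2 i hi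
      · exact hck i (not_lt.1 h)
  have hcV : c ∈ V := by
    refine htV fun i hi => ?_
    rw [hc i (lt_of_lt_of_le (Nat.lt_succ_of_le (hB hi)) (le_max_left _ _))]
    exact mem_of_mem_nhds (ht i)
  exact hVG (show (⟨c, hcK⟩ : K) ∈ Subtype.val ⁻¹' V from hcV) (subset_closure hcG)

/-- The set of sequences of natural numbers tending to infinity is not `Σ⁰₃`. -/
theorem not_isSigma_three_tendsto_atTop :
    ¬ BetaExpansion.IsSigma 3 {a : ℕ → ℕ | Tendsto a atTop atTop} := by
  rw [isSigma_three_iff]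
  rintro ⟨G, hG, hGe⟩
  have hGC : ∀ k, ∀ a ∈ G k, Tendsto a atTop atTop := fun k a ha => by
    have : a ∈ ⋃ k, G k := mem_iUnion.2 ⟨k, ha⟩
    rwa [← hGe] at this
  choose f g h1 h2 h3 h4 using fun k s L => exists_extension_avoiding (hG k) (hGC k) k s L
  -- A stage is a sequence together with the length of its frozen initial part. Step `k` freezes a
  -- longer part that avoids `G k` and keeps all new entries at least `k`, so the limit tends to
  -- infinity but lies in no `G k`.
  let st : ℕ → (ℕ → ℕ) × ℕ := fun k =>
    Nat.rec (fun _ => 0, 0) (fun k p => (f k p.1 p.2, g k p.1 p.2)) k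
  have hL : ∀ k, (st k).2 < (st (k + 1)).2 := fun k => h1 k _ _
  have hLm : StrictMono fun k => (st k).2 := strictMono_nat_of_lt_succ hL
  have hs : ∀ k, ∀ i < (st k).2, (st (k + 1)).1 i = (st k).1 i := fun k => h2 k _ _
  have hge : ∀ k, ∀ i, (st k).2 ≤ i → k ≤ (st (k + 1)).1 i := fun k => h3 k _ _
  have hcons : ∀ k m, k ≤ m → ∀ i < (st k).2, (st m).1 i = (st k).1 i := by
    intro k m hkm
    induction m, hkm using Nat.le_induction with
    | base => intros; rfl
    | succ m hm ih =>
      intro i hi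
      rw [hs m i (lt_of_lt_of_le hi (hLm.monotone hm)), ih i hi]
  have hlow : ∀ k m, k ≤ m → ∀ i, (st k).2 ≤ i → i < (st m).2 → k ≤ (st m).1 i := by
    intro k m hkm
    induction m, hkm using Nat.le_induction with
    | base => intro i h h'; omega
    | succ m hm ih =>
      intro i hi hi'
      by_cases h : i < (st m).2
      · rw [hs m i h]; exact ih i hi h
      · exact hm.trans (hge m i (not_lt.1 h))
  -- Stage `i + 1` has frozen at least `i + 1` entries, so entry `i` is final.
  let a : ℕ → ℕ := fun i => (st (i + 1)).1 i
  have hid : ∀ k, k ≤ (st k).2 := fun k => hLm.le_apply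
  have ha : ∀ k, ∀ i < (st k).2, a i = (st k).1 i := by
    intro k i hi
    have h' : i < (st (i + 1)).2 := hid (i + 1)
    rcases le_total k (i + 1) with h | h
    · exact hcons k (i + 1) h i hi
    · exact (hcons (i + 1) k h i h').symm
  have hak : ∀ k, ∀ i, (st k).2 ≤ i → k ≤ a i := by
    intro k i hi
    have h' : i < (st (i + 1)).2 := hid (i + 1)
    exact hlow k (i + 1) ((hid k).trans (hi.trans (Nat.le_succ i))) i hi h'
  have haC : a ∈ {a : ℕ → ℕ | Tendsto a atTop atTop} :=
    tendsto_atTop.2 fun k => eventually_atTop.2 ⟨_, hak k⟩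
  rw [hGe] at haC
  obtain ⟨k, hk⟩ := mem_iUnion.1 haC
  exact h4 k _ _ a (ha (k + 1)) (fun i hi => (Nat.le_succ k).trans (hak (k + 1) i hi)) hk

/-! ### Full words of the β-expansion -/

/-- The map `t ↦ βt mod 1` on the real line. -/
noncomputable def fractMap (β t : ℝ) : ℝ := Int.fract (β * t)

theorem fractMap_nonneg (β t : ℝ) : 0 ≤ fractMap β t := Int.fract_nonneg _

theorem fractMap_lt_one (β t : ℝ) : fractMap β t < 1 := Int.fract_lt_one _

theorem fractMap_of_eq_add {β t u : ℝ} (c : ℤ) (h : β * t = c + u) (h0 : 0 ≤ u) (h1 : u < 1) :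
    fractMap β t = u := by
  rw [fractMap, h, Int.fract_intCast_add, Int.fract_eq_self.2 ⟨h0, h1⟩]

/-- The effect of prepending a digit `c` to a word of value `A`: the map removes it again, and the
sum of distances gains one term. -/
theorem sum_abs_iterate_cons_le {β : ℝ} (hβ : 1 < β) {n : ℕ} {A y v S : ℝ} (c : ℤ)
    (hv0 : 0 ≤ A + β⁻¹ ^ n * v) (hv1 : A + β⁻¹ ^ n * v < 1)
    (hn : (fractMap β)^[n] (A + β⁻¹ ^ n * v) = v)
    (hS : ∑ r ∈ Finset.range n, |(fractMap β)^[r] (A + β⁻¹ ^ n * v)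
      - (fractMap β)^[r] (fractMap β y)| ≤ S) :
    (fractMap β)^[n + 1] ((c + A) / β + β⁻¹ ^ (n + 1) * v) = v ∧
    ∑ r ∈ Finset.range (n + 1), |(fractMap β)^[r] ((c + A) / β + β⁻¹ ^ (n + 1) * v)
      - (fractMap β)^[r] y| ≤ S + |(c + A) / β + β⁻¹ ^ (n + 1) * v - y| := by
  have hβ0 : β ≠ 0 := by positivity
  have h : fractMap β ((c + A) / β + β⁻¹ ^ (n + 1) * v) = A + β⁻¹ ^ n * v := by
    refine fractMap_of_eq_add c ?_ hv0 hv1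
    rw [pow_succ]
    field_simp
    ring
  refine ⟨by rw [Function.iterate_succ_apply, h, hn], ?_⟩
  rw [Finset.sum_range_succ']
  simp only [Function.iterate_succ_apply, h, Function.iterate_zero, id]
  linarith

/-- The word of value `A` consists of the first `n` digits of `y` with the last nonzero one lowered
by 1. It is built by prepending digits: either it is still all zeros, or its cylinder `[A, A + β⁻ⁿ)`
lies below `y`, and then further digits of `y` are copied. Here `q` bounds the initial distance and
`S` the summed distance; the relation `S = (2 - q) / (β - 1)` is preserved by copying, which divides
`q` by `β` and adds the new `q` to `S`. -/
theorem exists_full_word_aux {β : ℝ} (hβ : 1 < β) (n : ℕ) :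
    ∀ y : ℝ, 0 ≤ y → y < 1 → ∃ A q S : ℝ, 0 ≤ A ∧ 0 ≤ q ∧
      ((A = 0 ∧ q = β⁻¹ ^ n ∧ S = (1 - β⁻¹ ^ n) / (β - 1)) ∨
        (A + β⁻¹ ^ n ≤ y ∧ S = (2 - q) / (β - 1))) ∧
      ∀ v : ℝ, 0 ≤ v → v < 1 → (fractMap β)^[n] (A + β⁻¹ ^ n * v) = v ∧
        |A + β⁻¹ ^ n * v - y| ≤ q ∧
        ∑ r ∈ Finset.range n, |(fractMap β)^[r] (A + β⁻¹ ^ n * v) - (fractMap β)^[r] y| ≤ S := by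
  have hβ0 : 0 < β := by positivity
  have hβ1 : 0 < β - 1 := by linarith
  have hb : 0 < β⁻¹ := by positivity
  have hb1 : β⁻¹ < 1 := inv_lt_one_of_one_lt₀ hβ
  induction n with
  | zero =>
    intro y h0 h1
    refine ⟨0, 1, 0, le_rfl, zero_le_one, Or.inl ⟨rfl, by simp, by simp⟩, fun v hv0 hv1 => ?_⟩
    refine ⟨by simp, ?_, by simp⟩
    simp only [pow_zero, one_mul, zero_add]
    rw [abs_le]; constructor <;> linarith
  | succ n ih =>
    intro y h0 h1
    set y' := fractMap β y with hy'
    have hy'0 : 0 ≤ y' := fractMap_nonneg _ _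
    have hy'1 : y' < 1 := fractMap_lt_one _ _
    obtain ⟨A, q, S, hA, hq, hAq, H⟩ := ih y' hy'0 hy'1
    have hbn : 0 < β⁻¹ ^ n := by positivity
    have hbn1 : β⁻¹ ^ n ≤ 1 := pow_le_one₀ hb.le hb1.le
    have hAv : ∀ v : ℝ, 0 ≤ v → v < 1 → 0 ≤ A + β⁻¹ ^ n * v ∧ A + β⁻¹ ^ n * v < 1 := by
      intro v hv0 hv1
      refine ⟨by positivity, ?_⟩
      have : β⁻¹ ^ n * v < β⁻¹ ^ n := by nlinarith
      rcases hAq with ⟨h, -⟩ | ⟨h, -⟩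
      · rw [h]; linarith
      · linarith
    have hfl : (⌊β * y⌋ : ℝ) + y' = β * y := Int.floor_add_fract _
    have ha0 : 0 ≤ ⌊β * y⌋ := Int.floor_nonneg.2 (by positivity)
    have ha0' : (0 : ℝ) ≤ ⌊β * y⌋ := by exact_mod_cast ha0
    have hpow : β⁻¹ ^ (n + 1) = β⁻¹ ^ n / β := by rw [pow_succ]; rfl
    have hdiff : ∀ (c : ℤ) (v : ℝ), |(c + A) / β + β⁻¹ ^ (n + 1) * v - y|
        = |(c - ⌊β * y⌋) + (A + β⁻¹ ^ n * v - y')| / β := by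
      intro c v
      rw [← abs_of_pos hβ0, ← abs_div, abs_of_pos hβ0]
      congr 1
      rw [hpow]
      field_simp
      linear_combination hfl
    have keyq : ∀ q : ℝ, (2 - q) / (β - 1) + q / β = (2 - q / β) / (β - 1) := by
      intro q
      field_simp
      ring
    by_cases hle : A + β⁻¹ ^ n ≤ y'
    · have hS : S ≤ (2 - q) / (β - 1) := by
        rcases hAq with ⟨-, h1, h2⟩ | ⟨-, h⟩
        · rw [h2, h1]; gcongr; linarith
        · exact h.le
      refine ⟨(⌊β * y⌋ + A) / β, q / β, (2 - q / β) / (β - 1), by positivity, by positivity,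
        Or.inr ⟨?_, rfl⟩, fun v hv0 hv1 => ?_⟩
      · rw [hpow, ← add_div, div_le_iff₀ hβ0]; linarith
      · obtain ⟨h2, h3, h4⟩ := H v hv0 hv1
        have h5 := sum_abs_iterate_cons_le hβ ⌊β * y⌋ (hAv v hv0 hv1).1 (hAv v hv0 hv1).2 h2 h4
        have h6 : |((⌊β * y⌋ : ℤ) + A) / β + β⁻¹ ^ (n + 1) * v - y| ≤ q / β := by
          rw [hdiff, sub_self, zero_add]; gcongr
        exact ⟨h5.1, h6, by linarith [h5.2, keyq q]⟩
    · obtain ⟨hA0, hq1, hS⟩ : A = 0 ∧ q = β⁻¹ ^ n ∧ S = (1 - β⁻¹ ^ n) / (β - 1) := by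
        rcases hAq with h | h
        · exact h
        · exact absurd h.1 hle
      rcases ha0.eq_or_lt with haz | hap
      · refine ⟨0, β⁻¹ ^ (n + 1), _, le_rfl, by positivity, Or.inl ⟨rfl, rfl, rfl⟩,
          fun v hv0 hv1 => ?_⟩
        obtain ⟨h2, h3, h4⟩ := H v hv0 hv1
        have h5 := sum_abs_iterate_cons_le hβ 0 (hAv v hv0 hv1).1 (hAv v hv0 hv1).2 h2 h4
        have hz : (((0 : ℤ) : ℝ) + A) / β = 0 := by simp [hA0]
        have h6 : |(((0 : ℤ) : ℝ) + A) / β + β⁻¹ ^ (n + 1) * v - y| ≤ β⁻¹ ^ (n + 1) := by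
          rw [hdiff, ← haz, sub_self, zero_add, hpow]; gcongr; exact hq1 ▸ h3
        rw [hz] at h5 h6
        refine ⟨h5.1, h6, h5.2.trans ?_⟩
        rw [hS]
        have : (1 - β⁻¹ ^ n) / (β - 1) + β⁻¹ ^ (n + 1) = (1 - β⁻¹ ^ (n + 1)) / (β - 1) := by
          rw [hpow]; field_simp; ring
        linarith
      -- The only place where a digit is lowered; the word after it consists of zeros.
      · have hap' : (1 : ℝ) ≤ ⌊β * y⌋ := by exact_mod_cast hap
        refine ⟨(⌊β * y⌋ - 1 + A) / β, (1 + β⁻¹ ^ n) / β, (2 - (1 + β⁻¹ ^ n) / β) / (β - 1),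
          div_nonneg (by linarith) hβ0.le, by positivity, Or.inr ⟨?_, rfl⟩, fun v hv0 hv1 => ?_⟩
        · rw [hpow, ← add_div, div_le_iff₀ hβ0]; linarith
        · obtain ⟨h2, h3, h4⟩ := H v hv0 hv1
          have h5 := sum_abs_iterate_cons_le hβ (⌊β * y⌋ - 1) (hAv v hv0 hv1).1
            (hAv v hv0 hv1).2 h2 h4
          have h6 : |((⌊β * y⌋ - 1 : ℤ) + A) / β + β⁻¹ ^ (n + 1) * v - y|
              ≤ (1 + β⁻¹ ^ n) / β := by
            rw [hdiff]
            gcongr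
            refine (abs_add_le _ _).trans ?_
            refine add_le_add ?_ (h3.trans_eq hq1)
            push_cast
            simp
          have h7 : ((⌊β * y⌋ - 1 : ℤ) : ℝ) = ⌊β * y⌋ - 1 := by push_cast; rfl
          rw [h7] at h5 h6
          refine ⟨h5.1, h6, h5.2.trans ?_⟩
          have : (1 - β⁻¹ ^ n) / (β - 1) + (1 + β⁻¹ ^ n) / β
              = (2 - (1 + β⁻¹ ^ n) / β) / (β - 1) := by
            field_simp; ring
          rw [hS]
          linarith

/-- A word of length `n` can be changed into one that any expansion may follow, so that the orbits
stay at a total distance bounded independently of `n`. -/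
theorem exists_full_word {β : ℝ} (hβ : 1 < β) (n : ℕ) (y : ℝ) (h0 : 0 ≤ y) (h1 : y < 1) :
    ∃ A : ℝ, 0 ≤ A ∧ A + β⁻¹ ^ n ≤ 1 ∧ (n ≠ 0 → A + β⁻¹ ^ n < 1) ∧
      ∀ v : ℝ, 0 ≤ v → v < 1 → (fractMap β)^[n] (A + β⁻¹ ^ n * v) = v ∧
        ∑ r ∈ Finset.range n, |(fractMap β)^[r] (A + β⁻¹ ^ n * v) - (fractMap β)^[r] y|
          ≤ 2 / (β - 1) := by
  have hβ1 : 0 < β - 1 := by linarith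
  have hb : 0 < β⁻¹ := by positivity
  have hb1 : β⁻¹ < 1 := inv_lt_one_of_one_lt₀ hβ
  obtain ⟨A, q, S, hA, hq, h, H⟩ := exists_full_word_aux hβ n y h0 h1
  have hbn : 0 < β⁻¹ ^ n := by positivity
  have hbn1 : β⁻¹ ^ n ≤ 1 := pow_le_one₀ hb.le hb1.le
  have hS : S ≤ 2 / (β - 1) := by
    rcases h with ⟨-, -, h⟩ | ⟨-, h⟩ <;> rw [h] <;> gcongr <;> linarith
  refine ⟨A, hA, ?_, fun hn => ?_, fun v hv0 hv1 => ?_⟩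
  · rcases h with ⟨h, -⟩ | ⟨h, -⟩ <;> linarith
  · rcases h with ⟨h, -⟩ | ⟨h, -⟩
    · rw [h, zero_add]; exact pow_lt_one₀ hb.le hb1 hn
    · linarith
  · obtain ⟨h2, -, h4⟩ := H v hv0 hv1
    exact ⟨h2, h4.trans hS⟩

/-! ### Shadowing a sequence of orbit segments -/

/-- The triangular numbers. -/
def tri (j : ℕ) : ℕ := ∑ i ∈ Finset.range j, (i + 1)

theorem tri_succ (j : ℕ) : tri (j + 1) = tri j + (j + 1) := Finset.sum_range_succ _ _

theorem cast_tri (j : ℕ) : (tri j : ℝ) = j * (j + 1) / 2 := by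
  induction j with
  | zero => simp [tri]
  | succ j ih => rw [tri_succ]; push_cast; rw [ih]; ring

theorem le_tri (j : ℕ) : j ≤ tri j := by
  induction j with
  | zero => simp
  | succ j ih => rw [tri_succ]; omega

/-- Any sequence of orbit segments of lengths `1, 2, 3, …` can be followed by a single orbit, up to
a bounded total error on each segment; the point depends continuously on the segments. -/
theorem exists_shadowing {β : ℝ} (hβ : 1 < β) :
    ∃ P : (ℕ → Ico (0 : ℝ) 1) → ℝ, (∀ y, P y ∈ Ico (0 : ℝ) 1) ∧
      (∀ y y' : ℕ → Ico (0 : ℝ) 1, ∀ j : ℕ, (∀ i < j, y i = y' i) → |P y - P y'| ≤ β⁻¹ ^ j) ∧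
      ∀ y : ℕ → Ico (0 : ℝ) 1, ∀ j : ℕ,
        ∑ r ∈ Finset.range (j + 1),
          |(fractMap β)^[tri j + r] (P y) - (fractMap β)^[r] (y j)| ≤ 2 / (β - 1) := by
  have hb : 0 < β⁻¹ := by positivity
  have hb1 : β⁻¹ < 1 := inv_lt_one_of_one_lt₀ hβ
  choose! A hA0 hA1 hA2 hA3 using fun n y => exists_full_word hβ n y
  -- The left endpoint of the cylinder of the first `J` full words. These nested cylinders have
  -- length `β⁻¹ ^ tri J`, and their closures contain the point `P y`.
  let S : (ℕ → Ico (0 : ℝ) 1) → ℕ → ℝ := fun y J =>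
    ∑ l ∈ Finset.range J, β⁻¹ ^ tri l * A (l + 1) (y l)
  have hSs : ∀ y J, S y (J + 1) = S y J + β⁻¹ ^ tri J * A (J + 1) (y J) :=
    fun y J => Finset.sum_range_succ _ _
  have hmono : ∀ y, Monotone (S y) := fun y => monotone_nat_of_le_succ fun J => by
    rw [hSs]
    have := hA0 (J + 1) (y J) (y J).2.1 (y J).2.2
    have : 0 ≤ β⁻¹ ^ tri J * A (J + 1) (y J) := by positivity
    linarith
  have hanti : ∀ y, Antitone fun J => S y J + β⁻¹ ^ tri J := fun y =>
    antitone_nat_of_succ_le fun J => by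
      have h := hA1 (J + 1) (y J) (y J).2.1 (y J).2.2
      rw [hSs, tri_succ, pow_add]
      have : 0 < β⁻¹ ^ tri J := by positivity
      nlinarith
  have hle : ∀ y j J, S y J ≤ S y j + β⁻¹ ^ tri j := by
    intro y j J
    rcases le_total J j with h | h
    · have := hmono y h
      have : 0 < β⁻¹ ^ tri j := by positivity
      linarith
    · have := hanti y h
      have : 0 < β⁻¹ ^ tri J := by positivity
      simp only at *
      linarith
  have hbdd : ∀ y, BddAbove (range (S y)) := fun y =>
    ⟨S y 0 + β⁻¹ ^ tri 0, by rintro _ ⟨J, rfl⟩; exact hle y 0 J⟩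
  let P : (ℕ → Ico (0 : ℝ) 1) → ℝ := fun y => ⨆ J, S y J
  have hPl : ∀ y j, S y j ≤ P y := fun y j => le_ciSup (hbdd y) j
  have hPu : ∀ y j, P y ≤ S y j + β⁻¹ ^ tri j := fun y j => ciSup_le (hle y j)
  -- The relative position of `P y` in the `j`-th cylinder, which `hit` identifies with the orbit at
  -- time `tri j`.
  let X : (ℕ → Ico (0 : ℝ) 1) → ℕ → ℝ := fun y j => (P y - S y j) / β⁻¹ ^ tri j
  have hX0 : ∀ y j, 0 ≤ X y j := fun y j => by
    have := hPl y j
    exact div_nonneg (by linarith) (by positivity)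
  have hX1 : ∀ y j, X y j ≤ 1 := fun y j => by
    have := hPu y j
    rw [div_le_one (by positivity)]; linarith
  have hXs : ∀ y j, X y j = A (j + 1) (y j) + β⁻¹ ^ (j + 1) * X y (j + 1) := by
    intro y j
    have h1 : β⁻¹ ^ tri j ≠ 0 := by positivity
    have h2 : β⁻¹ ^ (j + 1) ≠ 0 := by positivity
    simp only [X]
    rw [hSs, tri_succ, pow_add β⁻¹ (tri j)]
    have key : ∀ p q a u s : ℝ, p ≠ 0 → q ≠ 0 →
        (u - s) / p = a + q * ((u - (s + p * a)) / (p * q)) := by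
      intro p q a u s hp hq
      field_simp
      ring
    exact key _ _ _ _ _ h1 h2
  -- Full words accept only continuations `v < 1`; the strict bound for nonempty words excludes the
  -- right endpoint.
  have hXlt : ∀ y j, X y j < 1 := by
    intro y j
    rw [hXs]
    have h := hA2 (j + 1) (y j) (y j).2.1 (y j).2.2 (by omega)
    have h' := hX1 y (j + 1)
    have : 0 < β⁻¹ ^ (j + 1) := by positivity
    nlinarith
  have hP : ∀ y, P y = X y 0 := fun y => by simp [X, S, tri]
  have hit : ∀ y j, (fractMap β)^[tri j] (P y) = X y j := by
    intro y j
    induction j with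
    | zero => simp [hP, tri]
    | succ j ih =>
      rw [tri_succ, add_comm, Function.iterate_add_apply, ih, hXs]
      exact (hA3 (j + 1) (y j) (y j).2.1 (y j).2.2 _ (hX0 y _) (hXlt y _)).1
  refine ⟨P, fun y => ?_, fun y y' j hyy => ?_, fun y j => ?_⟩
  · rw [hP]; exact ⟨hX0 y 0, hXlt y 0⟩
  · have hS : S y j = S y' j := Finset.sum_congr rfl fun l hl => by
      rw [hyy l (Finset.mem_range.1 hl)]
    have h1 := hPl y j
    have h2 := hPu y j
    have h3 := hPl y' j
    have h4 := hPu y' j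
    have h5 : β⁻¹ ^ tri j ≤ β⁻¹ ^ j := pow_le_pow_of_le_one hb.le hb1.le (le_tri j)
    rw [abs_le]
    constructor <;> linarith
  · have h := (hA3 (j + 1) (y j) (y j).2.1 (y j).2.2 _ (hX0 y (j + 1)) (hXlt y _)).2
    rw [← hXs, ← hit] at h
    refine le_of_eq_of_le (Finset.sum_congr rfl fun r _ => ?_) h
    rw [add_comm, Function.iterate_add_apply]

/-! ### Greedy balancing -/

/-- A greedy choice that keeps countably many sums of centred functions small. -/
theorem exists_balanced_seq {Y : Type*} (D : ℕ → ℕ → Y → ℝ) (hD : ∀ k j y, |D k j y| ≤ j + 1)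
    (h : ∀ (j : ℕ) (c : ℕ → ℝ), ∃ y, ∑ k ∈ Finset.range (j + 1), c k * D k j y ≤ 0) :
    ∃ y : ℕ → Y, ∀ k j : ℕ,
      (∑ i ∈ Finset.Ico k j, D k i (y i)) ^ 2 ≤ 2 ^ k * (2 * (j : ℝ) ^ 3) := by
  choose f hf using h
  -- `e j k` is the accumulated error of the `k`-th function, which joins at time `k` so that only
  -- finitely many are active. The next point is chosen so that its increment has nonpositive
  -- weighted inner product with the current errors.
  let e : ℕ → ℕ → ℝ := fun j => Nat.rec (fun _ => 0) (fun j e k =>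
    e k + if k ≤ j then D k j (f j fun k => (1 / 2) ^ k * e k) else 0) j
  let y : ℕ → Y := fun j => f j fun k => (1 / 2) ^ k * e j k
  have hes : ∀ j k, e (j + 1) k = e j k + if k ≤ j then D k j (y j) else 0 := fun j k => rfl
  have he : ∀ k j, e j k = ∑ i ∈ Finset.Ico k j, D k i (y i) := by
    intro k j
    induction j with
    | zero => simp [e]
    | succ j ih =>
      rw [hes, ih]
      split_ifs with hkj
      · rw [Finset.sum_Ico_succ_top hkj]
      · rw [Finset.Ico_eq_empty (by omega), Finset.Ico_eq_empty (by omega)]; simp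
  -- The cross terms are nonpositive and the weights sum to at most 2, so this energy grows by at
  -- most `2 (j + 1) ^ 2` per step.
  have hQ : ∀ j : ℕ, ∑ k ∈ Finset.range j, (1 / 2 : ℝ) ^ k * e j k ^ 2 ≤ 2 * (j : ℝ) ^ 3 := by
    intro j
    induction j with
    | zero => simp
    | succ j ih =>
      have h1 : ∀ k ∈ Finset.range (j + 1), (1 / 2 : ℝ) ^ k * e (j + 1) k ^ 2 ≤
          (1 / 2 : ℝ) ^ k * e j k ^ 2 + 2 * (((1 / 2 : ℝ) ^ k * e j k) * D k j (y j))
            + (1 / 2 : ℝ) ^ k * ((j : ℝ) + 1) ^ 2 := by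
        intro k hk
        rw [hes, if_pos (Nat.lt_succ_iff.1 (Finset.mem_range.1 hk))]
        have h2 : D k j (y j) ^ 2 ≤ ((j : ℝ) + 1) ^ 2 := by
          rw [← sq_abs]
          have := hD k j (y j)
          gcongr
        have h3 : (0 : ℝ) < (1 / 2) ^ k := by positivity
        nlinarith
      refine (Finset.sum_le_sum h1).trans ?_
      rw [Finset.sum_add_distrib, Finset.sum_add_distrib, ← Finset.mul_sum, ← Finset.sum_mul,
        Finset.sum_range_succ (fun k => (1 / 2 : ℝ) ^ k * e j k ^ 2)]
      have h4 : e j j = 0 := by rw [he]; simp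
      have h5 := hf j fun k => (1 / 2) ^ k * e j k
      have h6 := sum_geometric_two_le (j + 1)
      have h7 : (0 : ℝ) ≤ j := Nat.cast_nonneg j
      rw [h4]
      push_cast
      change ∑ k ∈ Finset.range (j + 1), (1 / 2 : ℝ) ^ k * e j k * D k j (y j) ≤ 0 at h5
      nlinarith [mul_le_mul_of_nonneg_right h6 (sq_nonneg ((j : ℝ) + 1)), sq_nonneg (j : ℝ)]
  refine ⟨y, fun k j => ?_⟩
  rw [← he]
  rcases lt_or_ge k j with hkj | hkj
  · have h1 := (Finset.single_le_sum (f := fun k => (1 / 2 : ℝ) ^ k * e j k ^ 2)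
      (fun i _ => by positivity) (Finset.mem_range.2 hkj)).trans (hQ j)
    simp only [one_div, inv_pow] at h1
    rwa [inv_mul_le_iff₀ (by positivity)] at h1
  · rw [he, Finset.Ico_eq_empty (by omega)]
    rw [Finset.sum_empty, zero_pow two_ne_zero]
    positivity

/-! ### Perturbing dyadic blocks -/

/-- The indices of the initial part of relative length about `1 / (α b + 3)` of each dyadic block
`[2 ^ b, 2 ^ (b + 1))`. -/
def Perturbed (α : ℕ → ℕ) (i : ℕ) : Prop :=
  (i - 2 ^ Nat.log 2 i) * (α (Nat.log 2 i) + 3) ≤ 2 ^ Nat.log 2 i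

instance (α : ℕ → ℕ) : DecidablePred (Perturbed α) := fun _ => Nat.decLe _ _

/-- Once `α b ≥ K`, block `b` has at most `2 ^ b / K + 1` perturbed indices. Summing over blocks,
and rounding `j` up to a power of 2, bounds their number below `j` by `4 j / K` for large `j`. -/
theorem card_perturbed_isLittleO {α : ℕ → ℕ} (hα : Tendsto α atTop atTop) :
    (fun j : ℕ => (((Finset.range j).filter (Perturbed α)).card : ℝ)) =o[atTop]
      fun j : ℕ => (j : ℝ) := by
  have key : ∀ K : ℕ, 0 < K → ∀ᶠ j : ℕ in atTop,
      K * ((Finset.range j).filter (Perturbed α)).card ≤ 4 * j := by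
    intro K hK
    obtain ⟨b₀, hb₀⟩ := eventually_atTop.1 (hα.eventually_ge_atTop K)
    let s : ℕ → ℕ := fun B => ((Finset.range (2 ^ B)).filter (Perturbed α)).card
    have hs : ∀ B, b₀ ≤ B → K * s B ≤ K * 2 ^ b₀ + 2 ^ B + K * B := by
      intro B hB
      induction B, hB using Nat.le_induction with
      | base =>
        have : s b₀ ≤ 2 ^ b₀ := (Finset.card_filter_le _ _).trans_eq (Finset.card_range _)
        have := Nat.mul_le_mul_left K this
        omega
      | succ B hB ih =>
        have hsub : (Finset.range (2 ^ (B + 1))).filter (Perturbed α) ⊆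
            (Finset.range (2 ^ B)).filter (Perturbed α) ∪
              Finset.Icc (2 ^ B) (2 ^ B + 2 ^ B / K) := by
          intro i hi
          rw [Finset.mem_filter, Finset.mem_range] at hi
          rw [Finset.mem_union, Finset.mem_filter, Finset.mem_range, Finset.mem_Icc]
          by_cases h : i < 2 ^ B
          · exact Or.inl ⟨h, hi.2⟩
          · right
            have hl : Nat.log 2 i = B := Nat.log_eq_of_pow_le_of_lt_pow (not_lt.1 h) hi.1
            have hp := hi.2
            rw [Perturbed, hl] at hp
            refine ⟨not_lt.1 h, ?_⟩
            have : i - 2 ^ B ≤ 2 ^ B / K := by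
              rw [Nat.le_div_iff_mul_le hK]
              exact (Nat.mul_le_mul_left _ ((hb₀ B hB).trans (Nat.le_add_right _ 3))).trans hp
            omega
        have h1 : s (B + 1) ≤ s B + (2 ^ B / K + 1) := by
          refine (Finset.card_le_card hsub).trans ((Finset.card_union_le _ _).trans ?_)
          rw [Nat.card_Icc]
          change s B + _ ≤ _
          generalize 2 ^ B / K = d
          omega
        have h2 := Nat.mul_le_mul_left K h1
        have h3 : K * (2 ^ B / K) ≤ 2 ^ B := Nat.mul_div_le _ _
        have h4 : 2 ^ (B + 1) = 2 ^ B + 2 ^ B := by ring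
        have h5 : K * (s B + (2 ^ B / K + 1)) = K * s B + K * (2 ^ B / K) + K := by ring
        have h6 : K * (B + 1) = K * B + K := by ring
        omega
    have hev : ∀ᶠ B : ℕ in atTop, K * 2 ^ b₀ + K * B ≤ 2 ^ B := by
      have t0 := (tendsto_pow_const_div_const_pow_of_one_lt 0 (one_lt_two : (1 : ℝ) < 2)).const_mul
        ((K : ℝ) * 2 ^ b₀)
      have t1 := (tendsto_pow_const_div_const_pow_of_one_lt 1 (one_lt_two : (1 : ℝ) < 2)).const_mul
        (K : ℝ)
      have t := t0.add t1
      rw [mul_zero, mul_zero, add_zero] at t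
      filter_upwards [t.eventually_lt_const one_pos] with B hB
      rw [← mul_div_assoc, ← mul_div_assoc, ← add_div, div_lt_one (by positivity)] at hB
      simp only [pow_zero, mul_one, pow_one] at hB
      exact_mod_cast hB.le
    obtain ⟨B₁, hB₁⟩ := eventually_atTop.1 hev
    filter_upwards [eventually_ge_atTop (2 ^ max b₀ B₁)] with j hj
    have hj0 : j ≠ 0 := by
      have : 0 < 2 ^ max b₀ B₁ := by positivity
      omega
    have hlog : max b₀ B₁ ≤ Nat.log 2 j := Nat.le_log_of_pow_le one_lt_two hj
    have h1 : 2 ^ Nat.log 2 j ≤ j := Nat.pow_log_le_self 2 hj0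
    have h2 : j < 2 ^ (Nat.log 2 j + 1) := Nat.lt_pow_succ_log_self one_lt_two j
    have h3 : ((Finset.range j).filter (Perturbed α)).card ≤ s (Nat.log 2 j + 1) :=
      Finset.card_le_card (Finset.filter_subset_filter _ (Finset.range_subset_range.2 h2.le))
    have h4 := hs (Nat.log 2 j + 1) (by omega)
    have h5 := hB₁ (Nat.log 2 j + 1) (by omega)
    have h6 := Nat.mul_le_mul_left K h3
    rw [pow_succ] at h4 h5
    omega
  rw [isLittleO_iff]
  intro ε hε
  obtain ⟨K, hK⟩ := exists_nat_gt (4 / ε)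
  have hK0 : (0 : ℝ) < K := lt_trans (by positivity) hK
  filter_upwards [key K (by exact_mod_cast hK0)] with j hj
  have hj' : (K : ℝ) * ((Finset.range j).filter (Perturbed α)).card ≤ 4 * j := by
    exact_mod_cast hj
  rw [Real.norm_of_nonneg (Nat.cast_nonneg _), Real.norm_of_nonneg (Nat.cast_nonneg _)]
  rw [div_lt_iff₀ hε] at hK
  have hj0 : (0 : ℝ) ≤ j := Nat.cast_nonneg j
  by_contra! hcon
  nlinarith [mul_lt_mul_of_pos_left hcon hK0, mul_le_mul_of_nonneg_right hK.le hj0]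

/-- Each perturbed index below `j` changes the sum by at most `j`, and there are `o(j)` of them. -/
theorem sum_perturbed_isLittleO {α : ℕ → ℕ} (hα : Tendsto α atTop atTop) {u w z : ℕ → ℝ}
    (hu : ∀ i, u i = if Perturbed α i then z i else w i)
    (hw : ∀ i : ℕ, w i ∈ Icc (0 : ℝ) (i + 1)) (hz : ∀ i : ℕ, z i ∈ Icc (0 : ℝ) (i + 1)) {M : ℝ}
    (hM : (fun j : ℕ => ∑ i ∈ Finset.range j, (w i - (i + 1) * M)) =o[atTop]
      fun j : ℕ => (j : ℝ) ^ 2) :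
    (fun j : ℕ => ∑ i ∈ Finset.range j, (u i - (i + 1) * M)) =o[atTop]
      fun j : ℕ => (j : ℝ) ^ 2 := by
  have h1 : (fun j : ℕ => ∑ i ∈ Finset.range j, (u i - w i)) =o[atTop]
      fun j : ℕ => (j : ℝ) ^ 2 := by
    have h2 := (isBigO_refl (fun j : ℕ => (j : ℝ)) atTop).mul_isLittleO
      (card_perturbed_isLittleO hα)
    simp only [← sq] at h2
    refine IsBigO.trans_isLittleO (IsBigO.of_bound 1 (Eventually.of_forall fun j => ?_)) h2
    rw [one_mul, Real.norm_of_nonneg (by positivity : (0 : ℝ) ≤ _ * _), Real.norm_eq_abs]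
    refine (Finset.abs_sum_le_sum_abs _ _).trans ?_
    rw [Finset.card_filter, Nat.cast_sum, Finset.mul_sum]
    refine Finset.sum_le_sum fun i hi => ?_
    have hij : (i : ℝ) + 1 ≤ j := by exact_mod_cast Finset.mem_range.1 hi
    rw [hu]
    split_ifs
    · have := hw i
      have := hz i
      rw [abs_le]
      simp only [mem_Icc, Nat.cast_one, mul_one] at *
      constructor <;> linarith
    · simp
  refine (hM.add h1).congr_left fun j => ?_
  rw [← Finset.sum_add_distrib]
  exact Finset.sum_congr rfl fun i _ => by ring

/-- The second half of each dyadic block is never perturbed, which forces `c = M`. If `α b < K` for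
infinitely many `b`, the start of these blocks shifts the sum, in the direction given by the sign
`s`, by at least `δ 4 ^ b / (K + 3)`, too much for `o(j²)`. -/
theorem tendsto_of_sum_perturbed_isLittleO {α : ℕ → ℕ} {u w z : ℕ → ℝ}
    (hu : ∀ i, u i = if Perturbed α i then z i else w i) {M c δ s : ℝ}
    (hM : (fun j : ℕ => ∑ i ∈ Finset.range j, (w i - (i + 1) * M)) =o[atTop]
      fun j : ℕ => (j : ℝ) ^ 2)
    (hδ : 0 < δ) (hs : |s| ≤ 1) (hz : ∀ i : ℕ, δ * (i + 1) ≤ s * (z i - (i + 1) * M))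
    (hc : (fun j : ℕ => ∑ i ∈ Finset.range j, (u i - (i + 1) * c)) =o[atTop]
      fun j : ℕ => (j : ℝ) ^ 2) :
    Tendsto α atTop atTop := by
  have hpow : Tendsto (fun b : ℕ => 2 ^ b) atTop atTop :=
    tendsto_pow_atTop_atTop_of_one_lt one_lt_two
  have hcM : c = M := by
    by_contra hne
    have hpos : 0 < |c - M| := abs_pos.2 (sub_ne_zero.2 hne)
    have hG := hM.sub hc
    rw [isLittleO_iff] at hG
    -- The half block contributes at least `3 |c - M| 4 ^ b`, but the errors at its two ends total
    -- at most `(16 + 9) / 10` times `|c - M| 4 ^ b`.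
    obtain ⟨j₀, hj₀⟩ := eventually_atTop.1 (hG (c := |c - M| / 10) (by positivity))
    obtain ⟨b, hb⟩ := (hpow.eventually_ge_atTop j₀).exists
    have h4 := hj₀ (4 * 2 ^ b) (by omega)
    have h3 := hj₀ (3 * 2 ^ b) (by omega)
    have hdiff : (∑ i ∈ Finset.range (4 * 2 ^ b), (w i - (i + 1) * M)
        - ∑ i ∈ Finset.range (4 * 2 ^ b), (u i - (i + 1) * c))
        - (∑ i ∈ Finset.range (3 * 2 ^ b), (w i - (i + 1) * M)
        - ∑ i ∈ Finset.range (3 * 2 ^ b), (u i - (i + 1) * c))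
        = (c - M) * ∑ i ∈ Finset.Ico (3 * 2 ^ b) (4 * 2 ^ b), (((i : ℕ) : ℝ) + 1) := by
      rw [← Finset.sum_sub_distrib, ← Finset.sum_sub_distrib,
        ← Finset.sum_Ico_eq_sub _ (by omega), Finset.mul_sum]
      refine Finset.sum_congr rfl fun i hi => ?_
      rw [Finset.mem_Ico] at hi
      have hl : Nat.log 2 i = b + 1 := Nat.log_eq_of_pow_le_of_lt_pow
        (by rw [pow_succ]; omega) (by rw [pow_succ, pow_succ]; omega)
      -- The summand 3 in `Perturbed` keeps the perturbed part within the first third of the block.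
      have hnp : ¬ Perturbed α i := by
        rw [Perturbed, hl, not_le]
        have h1 : 2 ^ b ≤ i - 2 ^ (b + 1) := by rw [pow_succ]; omega
        have h2 : 0 < 2 ^ b := by positivity
        calc 2 ^ (b + 1) < 2 ^ b * 3 := by rw [pow_succ]; omega
          _ ≤ (i - 2 ^ (b + 1)) * (α (b + 1) + 3) := Nat.mul_le_mul h1 (by omega)
      rw [hu, if_neg hnp]
      ring
    have hlow : 3 * ((2 : ℝ) ^ b) ^ 2 ≤
        ∑ i ∈ Finset.Ico (3 * 2 ^ b) (4 * 2 ^ b), (((i : ℕ) : ℝ) + 1) := by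
      have := Finset.card_nsmul_le_sum (Finset.Ico (3 * 2 ^ b) (4 * 2 ^ b))
        (fun i : ℕ => (i : ℝ) + 1) (3 * 2 ^ b) (fun i hi => by
          have : ((3 * 2 ^ b : ℕ) : ℝ) ≤ i := by exact_mod_cast (Finset.mem_Ico.1 hi).1
          push_cast at this
          linarith)
      rw [Nat.card_Ico, show 4 * 2 ^ b - 3 * 2 ^ b = 2 ^ b by omega, nsmul_eq_mul] at this
      push_cast at this
      nlinarith
    have habs := congrArg abs hdiff
    rw [abs_mul] at habs
    have htri := abs_sub (∑ i ∈ Finset.range (4 * 2 ^ b), (w i - (i + 1) * M)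
        - ∑ i ∈ Finset.range (4 * 2 ^ b), (u i - (i + 1) * c))
        (∑ i ∈ Finset.range (3 * 2 ^ b), (w i - (i + 1) * M)
        - ∑ i ∈ Finset.range (3 * 2 ^ b), (u i - (i + 1) * c))
    rw [habs] at htri
    simp only [Real.norm_eq_abs, abs_pow, Nat.abs_cast] at h3 h4
    push_cast at h3 h4
    have hm : (0 : ℝ) < ((2 : ℝ) ^ b) ^ 2 := by positivity
    have h6 := mul_le_mul_of_nonneg_left (hlow.trans (le_abs_self _)) hpos.le
    nlinarith [mul_pos hpos hm]
  subst hcM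
  by_contra hα
  rw [tendsto_atTop] at hα
  push Not at hα
  obtain ⟨K, hK⟩ := hα
  rw [isLittleO_iff] at hc
  have hK3 : (0 : ℝ) < K + 3 := by positivity
  -- The errors at `2 ^ b` and `2 ^ b + q ≤ 2 * 2 ^ b` involve at most `(1 + 4) 4 ^ b`, so 6 in the
  -- denominator suffices.
  obtain ⟨j₀, hj₀⟩ := eventually_atTop.1 (hc (c := δ / (6 * (K + 3))) (by positivity))
  obtain ⟨b, hbK, hb⟩ := (hK.and_eventually (hpow.eventually_ge_atTop j₀)).exists
  have hm0 : 0 < 2 ^ b := by positivity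
  obtain ⟨q, hqle, hqge, hqm⟩ : ∃ q, q ≤ 2 ^ b ∧ 2 ^ b ≤ (K + 3) * q ∧
      ∀ x < q, x * (K + 3) ≤ 2 ^ b :=
    ⟨2 ^ b / (K + 3) + 1, Nat.div_lt_self hm0 (by omega),
      (Nat.lt_mul_div_succ (2 ^ b) (show 0 < K + 3 by omega)).le, fun x hx =>
      (Nat.mul_le_mul_right _ (Nat.lt_succ_iff.1 hx)).trans (Nat.div_mul_le_self _ _)⟩
  have h1 := hj₀ (2 ^ b) hb
  have h2 := hj₀ (2 ^ b + q) (by omega)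
  have hdiff := Finset.sum_Ico_eq_sub (fun i : ℕ => u i - (i + 1) * c)
    (show 2 ^ b ≤ 2 ^ b + q by omega)
  have hlow : δ * (q * 2 ^ b) ≤
      s * ∑ i ∈ Finset.Ico (2 ^ b) (2 ^ b + q), (u i - (i + 1) * c) := by
    rw [Finset.mul_sum]
    have := Finset.card_nsmul_le_sum (Finset.Ico (2 ^ b) (2 ^ b + q))
      (fun i : ℕ => s * (u i - (i + 1) * c)) (δ * 2 ^ b) (fun i hi => by
        rw [Finset.mem_Ico] at hi
        have hl : Nat.log 2 i = b := Nat.log_eq_of_pow_le_of_lt_pow hi.1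
          (by rw [pow_succ]; omega)
        have hp : Perturbed α i := by
          rw [Perturbed, hl]
          exact (Nat.mul_le_mul_left _ (by omega)).trans (hqm (i - 2 ^ b) (by omega))
        have hi' : (2 : ℝ) ^ b ≤ i := by exact_mod_cast hi.1
        rw [hu, if_pos hp]
        refine le_trans ?_ (hz i)
        gcongr
        linarith)
    rw [Nat.card_Ico, Nat.add_sub_cancel_left, nsmul_eq_mul] at this
    linarith
  have hup : s * ∑ i ∈ Finset.Ico (2 ^ b) (2 ^ b + q), (u i - (i + 1) * c) ≤
      |∑ i ∈ Finset.Ico (2 ^ b) (2 ^ b + q), (u i - (i + 1) * c)| := by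
    refine (le_abs_self _).trans ?_
    rw [abs_mul]
    exact mul_le_of_le_one_left (abs_nonneg _) hs
  rw [hdiff] at hup hlow
  have htri := abs_sub (∑ i ∈ Finset.range (2 ^ b + q), (u i - (i + 1) * c))
    (∑ i ∈ Finset.range (2 ^ b), (u i - (i + 1) * c))
  simp only [Real.norm_eq_abs, abs_pow, Nat.abs_cast] at h1 h2
  push_cast at h1 h2
  have hq1 : (2 : ℝ) ^ b ≤ (K + 3) * q := by exact_mod_cast hqge
  have hq2 : (q : ℝ) ≤ 2 ^ b := by exact_mod_cast hqle
  have hm : (0 : ℝ) < (2 : ℝ) ^ b := by positivity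
  have hq0 : (0 : ℝ) ≤ q := Nat.cast_nonneg q
  have hsq : ((2 : ℝ) ^ b + q) ^ 2 ≤ 4 * (2 ^ b) ^ 2 := by nlinarith
  have h3 : δ * (q * 2 ^ b) ≤ δ / (6 * (K + 3)) * (5 * (2 ^ b) ^ 2) := by
    have : δ / (6 * (K + 3)) * ((2 : ℝ) ^ b + q) ^ 2 ≤ δ / (6 * (K + 3)) * (4 * (2 ^ b) ^ 2) := by
      gcongr
    linarith
  have h4 : δ / (6 * (K + 3)) * (5 * ((2 : ℝ) ^ b) ^ 2) = δ * (5 / 6 * ((2 ^ b) ^ 2 / (K + 3))) := by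
    field_simp
  rw [h4, mul_le_mul_iff_right₀ hδ] at h3
  have h5 : ((2 : ℝ) ^ b) ^ 2 / (K + 3) ≤ q * 2 ^ b := by
    rw [div_le_iff₀ hK3]
    nlinarith
  have h6 : 0 < ((2 : ℝ) ^ b) ^ 2 / (K + 3) := by positivity
  linarith

/-! ### Orbit averages and the continuous reduction -/

theorem fractMap_iterate_mem_Icc (β : ℝ) {x : ℝ} (hx : x ∈ Icc (0 : ℝ) 1) (n : ℕ) :
    (fractMap β)^[n] x ∈ Icc (0 : ℝ) 1 := by
  cases n with
  | zero => exact hx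
  | succ n =>
    rw [Function.iterate_succ_apply']
    exact ⟨fractMap_nonneg _ _, (fractMap_lt_one _ _).le⟩

theorem coe_betaMap_iterate (β : ℝ) (x : unitInterval) (n : ℕ) :
    (((BetaExpansion.betaMap β)^[n] x : unitInterval) : ℝ) = (fractMap β)^[n] (x : ℝ) := by
  induction n with
  | zero => rfl
  | succ n ih =>
    rw [Function.iterate_succ_apply', Function.iterate_succ_apply', ← ih]
    rfl

/-- The sum of the `k`-th powers over the orbit segment of `y` of length `i + 1`. -/
noncomputable def powSum (β : ℝ) (k i : ℕ) (y : ℝ) : ℝ :=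
  ∑ r ∈ Finset.range (i + 1), ((fractMap β)^[r] y) ^ k

theorem powSum_mem_Icc (β : ℝ) (k i : ℕ) {y : ℝ} (hy : y ∈ Icc (0 : ℝ) 1) :
    powSum β k i y ∈ Icc (0 : ℝ) (i + 1) := by
  have h := fractMap_iterate_mem_Icc β hy
  refine ⟨Finset.sum_nonneg fun r _ => pow_nonneg (h r).1 k, ?_⟩
  refine (Finset.sum_le_card_nsmul _ _ 1 fun r _ => pow_le_one₀ (h r).1 (h r).2).trans_eq ?_
  simp

theorem isLittleO_natCast_pow {m n : ℕ} (h : m < n) :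
    (fun j : ℕ => (j : ℝ) ^ m) =o[atTop] fun j : ℕ => (j : ℝ) ^ n :=
  (isLittleO_pow_pow_atTop_of_lt h).comp_tendsto tendsto_natCast_atTop_atTop

/-- Since `|a ^ k - b ^ k| ≤ k |a - b|` on `[0,1]`, shadowing costs `O(j)` up to time `tri j`, which
is of order `j²`. The times `tri j` suffice because the sums are monotone and consecutive triangular
numbers have ratio tending to 1. -/
theorem tendsto_average_iff {β : ℝ} {x C : ℝ} {y : ℕ → ℝ} (hx : x ∈ Icc (0 : ℝ) 1)
    (hy : ∀ i, y i ∈ Icc (0 : ℝ) 1)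
    (hxy : ∀ j : ℕ, ∑ r ∈ Finset.range (j + 1),
      |(fractMap β)^[tri j + r] x - (fractMap β)^[r] (y j)| ≤ C) (k : ℕ) (c : ℝ) :
    Tendsto (fun N : ℕ => (∑ n ∈ Finset.range N, ((fractMap β)^[n] x) ^ k) / N) atTop (𝓝 c) ↔
      (fun j : ℕ => ∑ i ∈ Finset.range j, (powSum β k i (y i) - (i + 1) * c)) =o[atTop]
        fun j : ℕ => (j : ℝ) ^ 2 := by
  set F : ℕ → ℝ := fun N => ∑ n ∈ Finset.range N, ((fractMap β)^[n] x) ^ k with hF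
  have hFtri : ∀ j, F (tri j) = ∑ i ∈ Finset.range j,
      ∑ r ∈ Finset.range (i + 1), ((fractMap β)^[tri i + r] x) ^ k := by
    intro j
    induction j with
    | zero => simp [F, tri]
    | succ j ih => rw [Finset.sum_range_succ, ← ih, tri_succ]; exact Finset.sum_range_add _ _ _
  have hseg : ∀ i, |(∑ r ∈ Finset.range (i + 1), ((fractMap β)^[tri i + r] x) ^ k)
      - powSum β k i (y i)| ≤ k * C := by
    intro i
    rw [powSum, ← Finset.sum_sub_distrib]
    refine (Finset.abs_sum_le_sum_abs _ _).trans ?_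
    refine le_trans ?_ (mul_le_mul_of_nonneg_left (hxy i) (Nat.cast_nonneg k))
    rw [Finset.mul_sum]
    refine Finset.sum_le_sum fun r _ => ?_
    have h1 := fractMap_iterate_mem_Icc β hx (tri i + r)
    have h2 := fractMap_iterate_mem_Icc β (hy i) r
    refine (abs_pow_sub_pow_le _ _ _).trans ?_
    rw [mul_comm (k : ℝ)]
    refine mul_le_of_le_one_right (by positivity) (pow_le_one₀ (by positivity) ?_)
    rw [abs_of_nonneg h1.1, abs_of_nonneg h2.1]
    exact max_le h1.2 h2.2
  have hdiff : (fun j : ℕ => (F (tri j) - c * tri j)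
      - ∑ i ∈ Finset.range j, (powSum β k i (y i) - (i + 1) * c)) =o[atTop]
      fun j : ℕ => (j : ℝ) ^ 2 := by
    refine IsBigO.trans_isLittleO ?_ (isLittleO_natCast_pow one_lt_two)
    refine IsBigO.of_bound (k * C) (Eventually.of_forall fun j => ?_)
    rw [pow_one, Real.norm_natCast, Real.norm_eq_abs]
    have : F (tri j) - c * tri j - ∑ i ∈ Finset.range j, (powSum β k i (y i) - (i + 1) * c)
        = ∑ i ∈ Finset.range j, ((∑ r ∈ Finset.range (i + 1), ((fractMap β)^[tri i + r] x) ^ k)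
          - powSum β k i (y i)) := by
      rw [hFtri, Finset.sum_sub_distrib, Finset.sum_sub_distrib, ← Finset.sum_mul, tri]
      push_cast
      ring
    rw [this]
    refine (Finset.abs_sum_le_sum_abs _ _).trans ?_
    refine (Finset.sum_le_card_nsmul _ _ _ fun i _ => hseg i).trans_eq ?_
    rw [Finset.card_range, nsmul_eq_mul, mul_comm]
  have htri0 : ∀ᶠ j : ℕ in atTop, (tri j : ℝ) ≠ 0 := by
    filter_upwards [eventually_ge_atTop 1] with j hj
    have := le_tri j
    exact_mod_cast (show tri j ≠ 0 by omega)
  have htri : Tendsto tri atTop atTop := tendsto_atTop_mono le_tri tendsto_id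
  have hiff : Tendsto (fun j : ℕ => F (tri j) / tri j) atTop (𝓝 c) ↔
      (fun j : ℕ => F (tri j) - c * tri j) =o[atTop] fun j : ℕ => (tri j : ℝ) := by
    rw [isLittleO_iff_tendsto' (htri0.mono fun j hj h => absurd h hj), ← tendsto_sub_nhds_zero_iff]
    refine tendsto_congr' (htri0.mono fun j hj => ?_)
    dsimp only
    field_simp
  have hbig1 : (fun j : ℕ => (tri j : ℝ)) =O[atTop] fun j : ℕ => (j : ℝ) ^ 2 := by
    refine IsBigO.of_bound 1 ?_
    filter_upwards [eventually_ge_atTop 1] with j hj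
    have hj' : (1 : ℝ) ≤ j := by exact_mod_cast hj
    rw [Real.norm_natCast, norm_pow, Real.norm_natCast, cast_tri]
    nlinarith
  have hbig2 : (fun j : ℕ => (j : ℝ) ^ 2) =O[atTop] fun j : ℕ => (tri j : ℝ) := by
    refine IsBigO.of_bound 2 (Eventually.of_forall fun j => ?_)
    rw [Real.norm_natCast, norm_pow, Real.norm_natCast, cast_tri]
    have : (0 : ℝ) ≤ j := Nat.cast_nonneg j
    nlinarith
  constructor
  · intro h
    have h1 := (hiff.1 (h.comp htri)).trans_isBigO hbig1
    exact (h1.sub hdiff).congr_left fun j => by ring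
  · intro h
    have h1 := hiff.2 (((h.add hdiff).congr_left fun j => by ring).trans_isBigO hbig2)
    refine tendsto_div_of_monotone_of_exists_subseq_tendsto_div F c ?_ fun a ha =>
      ⟨tri, ?_, htri, h1⟩
    · refine monotone_nat_of_le_succ fun N => ?_
      rw [hF]
      dsimp only
      rw [Finset.sum_range_succ]
      have := pow_nonneg (fractMap_iterate_mem_Icc β hx N).1 k
      linarith
    · obtain ⟨m, hm⟩ := exists_nat_gt (2 / (a - 1))
      filter_upwards [eventually_ge_atTop m] with j hj
      have hj' : (m : ℝ) ≤ j := by exact_mod_cast hj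
      rw [div_lt_iff₀ (by linarith)] at hm
      rw [cast_tri, cast_tri]
      push_cast
      have h2 : (j : ℝ) + 2 ≤ a * j := by nlinarith
      have h3 : (0 : ℝ) ≤ j := Nat.cast_nonneg j
      nlinarith

/-- The point with periodic expansion `(0…01)^∞`, with `M` zeros: its orbit is `z, βz, …, β ^ M z`,
and `β ^ (M + 1) z = 1 + z`. Large `M` ensures `β ^ M z < 1`. It serves as perturbation when the
mean of `μ` is 0. -/
theorem exists_le_fractMap_iterate {β : ℝ} (hβ : 1 < β) :
    ∃ z : ℝ, 0 < z ∧ z < 1 ∧ ∀ r, z ≤ (fractMap β)^[r] z := by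
  obtain ⟨M, hM⟩ := ((tendsto_pow_atTop_atTop_of_one_lt hβ).eventually_gt_atTop
    (1 / (β - 1))).exists
  have hβ1 : 0 < β - 1 := by linarith
  rw [div_lt_iff₀ hβ1] at hM
  have hβM : 0 < β ^ M := by positivity
  have hM' : 1 + β ^ M < β ^ (M + 1) := by rw [pow_succ]; linarith
  have hd : 0 < β ^ (M + 1) - 1 := by linarith
  set z := 1 / (β ^ (M + 1) - 1) with hz
  have hz0 : 0 < z := by positivity
  have hzM : β ^ M * z < 1 := by
    rw [hz, mul_one_div, div_lt_one hd]; linarith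
  have hz1 : z < 1 := by
    have : 1 ≤ β ^ M := one_le_pow₀ hβ.le
    nlinarith
  have hper : β ^ (M + 1) * z = 1 + z := by
    rw [hz]; field_simp; ring
  refine ⟨z, hz0, hz1, fun r => ?_⟩
  have key : ∀ r, ∃ i ≤ M, (fractMap β)^[r] z = β ^ i * z := by
    intro r
    induction r with
    | zero => exact ⟨0, Nat.zero_le _, by simp⟩
    | succ r ih =>
      obtain ⟨i, hi, h⟩ := ih
      rw [Function.iterate_succ_apply', h]
      rcases hi.lt_or_eq with hlt | rfl
      · refine ⟨i + 1, hlt, fractMap_of_eq_add 0 ?_ (by positivity) ?_⟩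
        · rw [pow_succ]; push_cast; ring
        · refine lt_of_le_of_lt ?_ hzM
          gcongr
          · exact hβ.le
          · exact hlt
      · refine ⟨0, Nat.zero_le _, ?_⟩
        rw [pow_zero, one_mul]
        refine fractMap_of_eq_add 1 ?_ hz0.le hz1
        rw [← mul_assoc, ← pow_succ', hper]; push_cast; rfl
  obtain ⟨i, -, h⟩ := key r
  rw [h]
  exact le_mul_of_one_le_left hz0.le (one_le_pow₀ hβ.le)

theorem integral_iterate_pow {β : ℝ} {μ : Measure unitInterval}
    (hT : MeasurePreserving (BetaExpansion.betaMap β) μ μ) (k r : ℕ) :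
    ∫ x : unitInterval, (((BetaExpansion.betaMap β)^[r] x : unitInterval) : ℝ) ^ k ∂μ
      = ∫ x : unitInterval, (x : ℝ) ^ k ∂μ := by
  have h := (hT.iterate r).map_eq
  conv_rhs => rw [← h]
  rw [integral_map (hT.measurable.iterate r).aemeasurable]
  exact (measurable_subtype_coe.pow_const k).aestronglyMeasurable

section Invariant

variable {β : ℝ} {μ : Measure unitInterval} [IsProbabilityMeasure μ]

theorem integrable_iterate_pow (hT : MeasurePreserving (BetaExpansion.betaMap β) μ μ) (k r : ℕ) :
    Integrable (fun x : unitInterval => (((BetaExpansion.betaMap β)^[r] x : unitInterval) : ℝ) ^ k)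
      μ := by
  refine Integrable.of_bound (C := 1) ?_ (Eventually.of_forall fun x => ?_)
  · exact ((measurable_subtype_coe.comp (hT.measurable.iterate r)).pow_const k).aestronglyMeasurable
  · have h := ((BetaExpansion.betaMap β)^[r] x).2
    rw [Real.norm_of_nonneg (pow_nonneg h.1 k)]
    exact pow_le_one₀ h.1 h.2

theorem integral_pow_mem_Icc (k : ℕ) : ∫ x : unitInterval, (x : ℝ) ^ k ∂μ ∈ Icc (0 : ℝ) 1 := by
  refine ⟨integral_nonneg fun x => pow_nonneg x.2.1 k, ?_⟩
  have h := norm_integral_le_of_norm_le_const (μ := μ) (C := 1)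
    (f := fun x : unitInterval => (x : ℝ) ^ k) (Eventually.of_forall fun x => by
      rw [Real.norm_of_nonneg (pow_nonneg x.2.1 k)]
      exact pow_le_one₀ x.2.1 x.2.2)
  simp only [probReal_univ, mul_one] at h
  exact (le_abs_self _).trans h

/-- There are orbit segments of lengths `1, 2, 3, …` whose concatenation has asymptotically
the moments of a given invariant measure. -/
theorem exists_segments (hT : MeasurePreserving (BetaExpansion.betaMap β) μ μ) :
    ∃ y : ℕ → Ico (0 : ℝ) 1, ∀ k : ℕ,
      (fun j : ℕ => ∑ i ∈ Finset.range j,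
        (powSum β k i (y i) - (i + 1) * ∫ x : unitInterval, (x : ℝ) ^ k ∂μ)) =o[atTop]
        fun j : ℕ => (j : ℝ) ^ 2 := by
  set M : ℕ → ℝ := fun k => ∫ x : unitInterval, (x : ℝ) ^ k ∂μ with hM
  let D : ℕ → ℕ → Ico (0 : ℝ) 1 → ℝ := fun k i y => powSum β k i y - (i + 1) * M k
  have hD : ∀ k j y, |D k j y| ≤ j + 1 := by
    intro k j y
    have h1 := powSum_mem_Icc β k j ⟨y.2.1, y.2.2.le⟩
    have h2 : M k ∈ Icc (0 : ℝ) 1 := integral_pow_mem_Icc k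
    have h3 : (0 : ℝ) ≤ j + 1 := by positivity
    have h4 := mul_nonneg h3 h2.1
    have h5 := mul_le_of_le_one_right h3 h2.2
    rw [abs_le]
    constructor
    · linarith [h1.1]
    · linarith [h1.2]
  -- The value 1 is never taken by the map, so the segments may start in `[0,1)`.
  have hone : μ {1} = 0 := by
    rw [← hT.measure_preimage (measurableSet_singleton _).nullMeasurableSet]
    have : BetaExpansion.betaMap β ⁻¹' {1} = ∅ := by
      refine eq_empty_of_forall_notMem fun x hx => ?_
      have h := congrArg Subtype.val (show BetaExpansion.betaMap β x = 1 from hx)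
      exact absurd h (Int.fract_lt_one _).ne
    rw [this, measure_empty]
  have hint : ∀ k j, Integrable (fun x : unitInterval => powSum β k j (x : ℝ)) μ ∧
      ∫ x : unitInterval, powSum β k j (x : ℝ) ∂μ = (j + 1) * M k := by
    intro k j
    have h : (fun x : unitInterval => powSum β k j (x : ℝ)) = fun x => ∑ r ∈ Finset.range (j + 1),
        (((BetaExpansion.betaMap β)^[r] x : unitInterval) : ℝ) ^ k := by
      funext x
      simp only [powSum, coe_betaMap_iterate]
    rw [h]
    refine ⟨integrable_finsetSum _ fun r _ => integrable_iterate_pow hT k r, ?_⟩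
    rw [integral_finsetSum _ fun r _ => integrable_iterate_pow hT k r]
    simp only [integral_iterate_pow hT]
    simp [hM]
  -- By invariance the combination has integral 0, so it is nonpositive somewhere off the null set
  -- `{1}`.
  have hneg : ∀ (j : ℕ) (c : ℕ → ℝ), ∃ y, ∑ k ∈ Finset.range (j + 1), c k * D k j y ≤ 0 := by
    intro j c
    have hi : ∀ k, Integrable (fun x : unitInterval => c k * (powSum β k j (x : ℝ)
        - (j + 1) * M k)) μ := fun k =>
      (((hint k j).1).sub (integrable_const _)).const_mul _
    have h0 : ∫ x : unitInterval, ∑ k ∈ Finset.range (j + 1), c k * (powSum β k j (x : ℝ)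
        - (j + 1) * M k) ∂μ = 0 := by
      rw [integral_finsetSum _ fun k _ => hi k]
      refine Finset.sum_eq_zero fun k _ => ?_
      rw [integral_const_mul, integral_sub (hint k j).1 (integrable_const _), (hint k j).2]
      simp
    obtain ⟨x, hx1, hx⟩ := exists_notMem_null_le_integral
      (integrable_finsetSum (Finset.range (j + 1)) fun k _ => hi k) hone
    rw [h0] at hx
    have hxlt : (x : ℝ) < 1 := lt_of_le_of_ne x.2.2 fun h => hx1 (Subtype.ext h)
    exact ⟨⟨x, x.2.1, hxlt⟩, hx⟩
  obtain ⟨y, hy⟩ := exists_balanced_seq D hD hneg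
  refine ⟨y, fun k => ?_⟩
  have h1 : (fun j : ℕ => ∑ i ∈ Finset.Ico k j, D k i (y i)) =o[atTop]
      fun j : ℕ => (j : ℝ) ^ 2 := by
    refine IsLittleO.of_pow (n := 2) ?_ two_ne_zero
    refine IsBigO.trans_isLittleO (g := fun j : ℕ => (j : ℝ) ^ 3) ?_ ?_
    · refine IsBigO.of_bound (2 ^ k * 2) (Eventually.of_forall fun j => ?_)
      have := hy k j
      simp only [Pi.pow_apply]
      rw [Real.norm_of_nonneg (sq_nonneg _), Real.norm_of_nonneg (by positivity)]
      linarith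
    · refine (isLittleO_natCast_pow (show 3 < 4 by norm_num)).congr_right fun j => ?_
      simp only [Pi.pow_apply]
      ring
  have h2 : (fun _ : ℕ => ∑ i ∈ Finset.range k, D k i (y i)) =o[atTop]
      fun j : ℕ => (j : ℝ) ^ 2 := by
    refine IsBigO.trans_isLittleO (IsBigO.of_bound |∑ i ∈ Finset.range k, D k i (y i)|
      (Eventually.of_forall fun j => ?_)) (isLittleO_natCast_pow (show 0 < 2 by norm_num))
    simp
  refine (h2.add h1).congr' ?_ EventuallyEq.rfl
  filter_upwards [eventually_ge_atTop k] with j hj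
  exact Finset.sum_range_add_sum_Ico _ hj

/-- A continuous map from Baire space to the unit interval that takes sequences tending to infinity
to points whose orbit has the moments of `μ`, and all others to points whose orbit has
no mean value. -/
theorem exists_continuous_reduction (hβ : 1 < β)
    (hT : MeasurePreserving (BetaExpansion.betaMap β) μ μ) :
    ∃ g : (ℕ → ℕ) → unitInterval, Continuous g ∧ ∀ α : ℕ → ℕ,
      (Tendsto α atTop atTop → ∀ k : ℕ, Tendsto (fun N : ℕ => (∑ n ∈ Finset.range N,
        (((BetaExpansion.betaMap β)^[n] (g α) : unitInterval) : ℝ) ^ k) / N) atTop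
        (𝓝 (∫ x : unitInterval, (x : ℝ) ^ k ∂μ))) ∧
      ∀ c : ℝ, Tendsto (fun N : ℕ => (∑ n ∈ Finset.range N,
        (((BetaExpansion.betaMap β)^[n] (g α) : unitInterval) : ℝ) ^ 1) / N) atTop (𝓝 c) →
        Tendsto α atTop atTop := by
  obtain ⟨y, hy⟩ := exists_segments hT
  obtain ⟨P, hP1, hP2, hP3⟩ := exists_shadowing hβ
  -- If the mean of `μ` is positive, the fixed point 0 has a smaller mean; if it is 0, an orbit
  -- bounded away from 0 has a larger one.
  have hz : ∃ z : Ico (0 : ℝ) 1, ∃ δ s : ℝ, 0 < δ ∧ |s| ≤ 1 ∧ ∀ i : ℕ,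
      δ * (i + 1) ≤ s * (powSum β 1 i z - (i + 1) * ∫ x : unitInterval, (x : ℝ) ^ 1 ∂μ) := by
    rcases (integral_pow_mem_Icc (μ := μ) 1).1.eq_or_lt with h | h
    · obtain ⟨z, hz0, hz1, hz⟩ := exists_le_fractMap_iterate hβ
      refine ⟨⟨z, hz0.le, hz1⟩, z, 1, hz0, by simp, fun i => ?_⟩
      rw [← h, mul_zero, sub_zero, one_mul, powSum]
      have := Finset.card_nsmul_le_sum (Finset.range (i + 1))
        (fun r => ((fractMap β)^[r] z) ^ 1) z fun r _ => by rw [pow_one]; exact hz r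
      rw [Finset.card_range, nsmul_eq_mul, mul_comm] at this
      exact_mod_cast this
    · refine ⟨⟨0, le_rfl, one_pos⟩, _, -1, h, by simp, fun i => ?_⟩
      have h0 : ∀ r, (fractMap β)^[r] 0 = 0 := fun r =>
        Function.iterate_fixed (by simp [fractMap]) r
      simp only [powSum, h0]
      simp [mul_comm]
  obtain ⟨z, δ, s, hδ, hs, hz⟩ := hz
  let Y : (ℕ → ℕ) → ℕ → Ico (0 : ℝ) 1 := fun α i => if Perturbed α i then z else y i
  have hYI : ∀ α i, (Y α i : ℝ) ∈ Icc (0 : ℝ) 1 := fun α i => ⟨(Y α i).2.1, (Y α i).2.2.le⟩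
  have hu : ∀ α k i, powSum β k i (Y α i)
      = if Perturbed α i then powSum β k i z else powSum β k i (y i) := by
    intro α k i
    simp only [Y]
    split_ifs <;> rfl
  have hPI : ∀ α, P (Y α) ∈ Icc (0 : ℝ) 1 := fun α => ⟨(hP1 _).1, (hP1 _).2.le⟩
  refine ⟨fun α => ⟨P (Y α), hPI α⟩, ?_, fun α => ⟨fun hα k => ?_, fun c hc => ?_⟩⟩
  · refine Continuous.subtype_mk (continuous_iff_continuousAt.2 fun α => ?_) _
    rw [ContinuousAt, Metric.tendsto_nhds]
    intro ε hε
    -- Segment `i` depends on `α` only through `α (Nat.log 2 i)`, so the first `b` values of `α`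
    -- determine the first `b` segments.
    obtain ⟨b, hb⟩ := exists_pow_lt_of_lt_one hε (inv_lt_one_of_one_lt₀ hβ)
    have hev : ∀ᶠ α' in 𝓝 α, ∀ i ∈ Finset.range b, α' i = α i :=
      (Filter.eventually_all_finset _).2 fun i _ =>
        ((continuous_apply i).tendsto α).eventually
          (eventually_of_mem ((isOpen_discrete {α i}).mem_nhds rfl) fun _ h => h)
    filter_upwards [hev] with α' hα'
    refine lt_of_le_of_lt (hP2 _ _ b fun i hi => ?_) hb
    have hl : α' (Nat.log 2 i) = α (Nat.log 2 i) :=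
      hα' _ (Finset.mem_range.2 (lt_of_le_of_lt (Nat.log_le_self 2 i) hi))
    simp only [Y, Perturbed, hl]
  · simp only [coe_betaMap_iterate]
    rw [tendsto_average_iff (hPI α) (hYI α) (hP3 (Y α))]
    exact sum_perturbed_isLittleO hα (hu α k)
      (fun i => powSum_mem_Icc β k i ⟨(y i).2.1, (y i).2.2.le⟩)
      (fun i => powSum_mem_Icc β k i ⟨z.2.1, z.2.2.le⟩) (hy k)
  · simp only [coe_betaMap_iterate] at hc
    rw [tendsto_average_iff (hPI α) (hYI α) (hP3 (Y α))] at hc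
    exact tendsto_of_sum_perturbed_isLittleO (hu α 1) (hy 1) hδ hs hz hc

end Invariant

/-! ### Generating a measure as convergence of moments -/

theorem hasFrequency_iff (S : Set ℕ) (a : ℝ) :
    BetaExpansion.HasFrequency S a ↔ Tendsto (fun N : ℕ =>
      (∑ n ∈ Finset.range N, S.indicator (fun _ => (1 : ℝ)) n) / N) atTop (𝓝 a) := by
  classical
  refine tendsto_congr fun N => ?_
  have : {n : ℕ | n < N ∧ n ∈ S} = ((Finset.range N).filter (· ∈ S) : Finset ℕ) := by
    ext n; simp
  rw [this, Set.ncard_coe_finset, Finset.card_filter]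
  push_cast
  rfl

/-- The empirical measure of the first `N + 1` terms of a sequence. -/
noncomputable def empiricalMeasure {X : Type*} [MeasurableSpace X] (u : ℕ → X) (N : ℕ) :
    ProbabilityMeasure X :=
  ⟨((N : ENNReal) + 1)⁻¹ • ∑ n ∈ Finset.range (N + 1), Measure.dirac (u n), ⟨by
    simp only [Measure.smul_apply, Measure.coe_finsetSum, Finset.sum_apply, measure_univ,
      Finset.sum_const, Finset.card_range, smul_eq_mul, nsmul_eq_mul, mul_one]
    push_cast
    exact ENNReal.inv_mul_cancel (by simp) (by finiteness)⟩⟩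

theorem integral_empiricalMeasure {X : Type*} [MeasurableSpace X] [MeasurableSingletonClass X]
    (u : ℕ → X) (N : ℕ) (f : X → ℝ) :
    ∫ x, f x ∂(empiricalMeasure u N : Measure X)
      = (∑ n ∈ Finset.range (N + 1), f (u n)) / ((N + 1 : ℕ) : ℝ) := by
  rw [empiricalMeasure, ProbabilityMeasure.coe_mk, integral_smul_measure,
    integral_finsetSum_measure fun n _ => integrable_dirac (by simp)]
  simp only [integral_dirac, ENNReal.toReal_inv, smul_eq_mul]
  rw [div_eq_inv_mul]
  congr 2
  rw [ENNReal.toReal_add (by finiteness) (by finiteness)]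
  push_cast
  simp

theorem tendsto_empiricalMeasure_apply_iff {X : Type*} [MeasurableSpace X]
    [MeasurableSingletonClass X] (u : ℕ → X) (μ : ProbabilityMeasure X) {J : Set X}
    (hJ : MeasurableSet J) :
    Tendsto (fun N => empiricalMeasure u N J) atTop (𝓝 (μ J)) ↔
      BetaExpansion.HasFrequency {n | u n ∈ J} ((μ : Measure X) J).toReal := by
  rw [hasFrequency_iff, ← NNReal.tendsto_coe]
  refine Iff.trans ?_ (tendsto_add_atTop_iff_nat 1)
  refine Eq.to_iff (congrArg₂ (fun a b => Tendsto a atTop (𝓝 b)) (funext fun N => ?_) rfl)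
  have h1 : ((empiricalMeasure u N J : NNReal) : ℝ)
      = (empiricalMeasure u N : Measure X).real J := rfl
  rw [h1, ← integral_indicator_one hJ, integral_empiricalMeasure]
  rfl

/-- Moments control polynomials, which are uniformly dense in the continuous functions on `[0,1]`.
-/
theorem tendsto_empiricalMeasure_of_moments {u : ℕ → unitInterval}
    {μ : ProbabilityMeasure unitInterval}
    (h : ∀ k : ℕ, Tendsto (fun N : ℕ => (∑ n ∈ Finset.range N, (u n : ℝ) ^ k) / N) atTop
      (𝓝 (∫ x : unitInterval, (x : ℝ) ^ k ∂(μ : Measure unitInterval)))) :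
    Tendsto (empiricalMeasure u) atTop (𝓝 μ) := by
  rw [ProbabilityMeasure.tendsto_iff_forall_integral_tendsto]
  intro f
  have hint : ∀ (ν : ProbabilityMeasure unitInterval) (φ : unitInterval → ℝ), Continuous φ →
      Integrable φ (ν : Measure unitInterval) := fun ν φ hφ =>
    hφ.integrable_of_hasCompactSupport (HasCompactSupport.of_compactSpace φ)
  have hpoly : ∀ p : Polynomial ℝ, Tendsto (fun N => ∫ x : unitInterval, p.eval (x : ℝ)
      ∂(empiricalMeasure u N : Measure unitInterval)) atTop
      (𝓝 (∫ x : unitInterval, p.eval (x : ℝ) ∂(μ : Measure unitInterval))) := by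
    intro p
    have hi : ∀ ν : ProbabilityMeasure unitInterval, ∫ x : unitInterval, p.eval (x : ℝ)
        ∂(ν : Measure unitInterval) = ∑ k ∈ Finset.range (p.natDegree + 1),
          p.coeff k * ∫ x : unitInterval, (x : ℝ) ^ k ∂(ν : Measure unitInterval) := by
      intro ν
      simp only [Polynomial.eval_eq_sum_range]
      rw [integral_finsetSum _ fun k _ => hint ν _ (by fun_prop)]
      exact Finset.sum_congr rfl fun k _ => integral_const_mul _ _
    simp only [hi]
    refine tendsto_finsetSum _ fun k _ => Tendsto.const_mul _ ?_
    have := (tendsto_add_atTop_iff_nat 1).2 (h k)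
    simpa only [integral_empiricalMeasure] using this
  rw [Metric.tendsto_atTop]
  intro ε hε
  obtain ⟨p, hp⟩ := exists_polynomial_near_continuousMap 0 1 f.toContinuousMap (ε / 3)
    (by positivity)
  have hpf : ∀ x : unitInterval, |f x - p.eval (x : ℝ)| ≤ ε / 3 := by
    intro x
    have := (ContinuousMap.norm_coe_le_norm (p.toContinuousMapOn (Icc 0 1) - f.toContinuousMap) x)
    rw [abs_sub_comm]
    exact this.trans hp.le
  have hclose : ∀ ν : ProbabilityMeasure unitInterval,
      |∫ x : unitInterval, f x ∂(ν : Measure unitInterval)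
        - ∫ x : unitInterval, p.eval (x : ℝ) ∂(ν : Measure unitInterval)| ≤ ε / 3 := by
    intro ν
    rw [← integral_sub (hint ν _ f.continuous) (hint ν _ (by fun_prop))]
    refine (norm_integral_le_of_norm_le_const (f := fun x : unitInterval => f x - p.eval (x : ℝ))
      (Eventually.of_forall hpf)).trans_eq ?_
    rw [probReal_univ, mul_one]
  obtain ⟨N₀, hN₀⟩ := Metric.tendsto_atTop.1 (hpoly p) (ε / 3) (by positivity)
  refine ⟨N₀, fun N hN => ?_⟩
  have h1 := hclose (empiricalMeasure u N)
  have h2 := hclose μ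
  have h3 := hN₀ N hN
  rw [Real.dist_eq, abs_lt] at *
  rw [abs_le] at h1 h2
  constructor <;> linarith [h1.1, h1.2, h2.1, h2.2, h3.1, h3.2]

/-- Intervals with null boundary form a π-system containing arbitrarily small neighbourhoods of
every point, hence determine weak convergence; the converse is the portmanteau theorem. -/
theorem generates_iff_tendsto_empiricalMeasure (T : unitInterval → unitInterval)
    (μ : ProbabilityMeasure unitInterval) (x : unitInterval) :
    BetaExpansion.Generates T μ x ↔
      Tendsto (empiricalMeasure fun n => T^[n] x) atTop (𝓝 μ) := by
  constructor
  · intro h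
    let 𝓢 : Set (Set unitInterval) :=
      {J | J.OrdConnected ∧ (μ : Measure unitInterval) (frontier J) = 0}
    have hpi : IsPiSystem 𝓢 := by
      rintro s ⟨hs, hs0⟩ t ⟨ht, ht0⟩ -
      refine ⟨hs.inter ht, measure_mono_null (frontier_inter_subset s t) ?_⟩
      exact measure_union_null (measure_mono_null inter_subset_left hs0)
        (measure_mono_null inter_subset_right ht0)
    refine hpi.tendsto_probabilityMeasure_of_tendsto_of_mem
      (fun s hs => hs.1.measurableSet) (fun u hu y hy => ?_) fun s hs => ?_
    · obtain ⟨ε, hε, hball⟩ := Metric.isOpen_iff.1 hu y hy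
      obtain ⟨r, hr, hr0⟩ := exists_null_frontier_thickening (μ : Measure unitInterval) {y} hε
      rw [Metric.thickening_singleton] at hr0
      refine ⟨Metric.ball y r, ⟨?_, hr0⟩, Metric.ball_mem_nhds y hr.1,
        (Metric.ball_subset_ball hr.2.le).trans hball⟩
      have : Metric.ball y r = Subtype.val ⁻¹' Metric.ball (y : ℝ) r := rfl
      rw [this, Real.ball_eq_Ioo]
      exact ordConnected_Ioo.preimage_mono (Subtype.mono_coe _)
    · rw [tendsto_empiricalMeasure_apply_iff _ _ hs.1.measurableSet]
      exact h s hs.1 hs.2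
  · intro h J hJ hJ0
    rw [← tendsto_empiricalMeasure_apply_iff _ _ hJ.measurableSet]
    exact ProbabilityMeasure.tendsto_measure_of_null_frontier_of_tendsto h
      ((ProbabilityMeasure.null_iff_toMeasure_null _ _).2 hJ0)

theorem generates_iff_moments (T : unitInterval → unitInterval) (μ : Measure unitInterval)
    [hμ : IsProbabilityMeasure μ] (x : unitInterval) :
    BetaExpansion.Generates T μ x ↔ ∀ k : ℕ, Tendsto (fun N : ℕ =>
      (∑ n ∈ Finset.range N, ((T^[n] x : unitInterval) : ℝ) ^ k) / N) atTop
        (𝓝 (∫ x : unitInterval, (x : ℝ) ^ k ∂μ)) := by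
  refine (generates_iff_tendsto_empiricalMeasure T ⟨μ, hμ⟩ x).trans ⟨fun h k => ?_,
    fun h => tendsto_empiricalMeasure_of_moments (μ := ⟨μ, hμ⟩) h⟩
  have h1 := ProbabilityMeasure.tendsto_iff_forall_integral_tendsto.1 h
    (BoundedContinuousFunction.mkOfCompact ⟨fun x : unitInterval => (x : ℝ) ^ k, by fun_prop⟩)
  simp only [BoundedContinuousFunction.mkOfCompact_apply, ContinuousMap.coe_mk,
    integral_empiricalMeasure] at h1
  exact (tendsto_add_atTop_iff_nat 1).1 h1

/-! ### Upper bounds in the Borel hierarchy -/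

section UpperBound

variable {β : ℝ}

/-- The points whose orbit reaches `0`: the only ones at which an iterate of the `β`-map
may be discontinuous. -/
def zeroOrbit (β : ℝ) : Set unitInterval := ⋃ n : ℕ, (BetaExpansion.betaMap β)^[n] ⁻¹' {0}

theorem countable_betaMap_preimage (hβ : 1 < β) {S : Set unitInterval} (hS : S.Countable) :
    (BetaExpansion.betaMap β ⁻¹' S).Countable := by
  have hβ0 : β ≠ 0 := by positivity
  refine countable_of_injective_of_countable_image (f := Subtype.val)
    Subtype.val_injective.injOn ((hS.prod (countable_univ : (univ : Set ℤ).Countable)).image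
      (fun q => ((q.1 : ℝ) + q.2) / β) |>.mono ?_)
  rintro _ ⟨x, hx, rfl⟩
  refine ⟨(BetaExpansion.betaMap β x, ⌊β * (x : ℝ)⌋), ⟨hx, mem_univ _⟩, ?_⟩
  simp only [BetaExpansion.betaMap, Int.fract_add_floor]
  field_simp

theorem countable_zeroOrbit (hβ : 1 < β) : (zeroOrbit β).Countable := by
  refine countable_iUnion fun n => ?_
  induction n with
  | zero => exact countable_singleton _
  | succ n ih =>
    rw [Function.iterate_succ, preimage_comp]
    exact countable_betaMap_preimage hβ ih

theorem continuousAt_betaMap {x : unitInterval} (hx : BetaExpansion.betaMap β x ≠ 0) :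
    ContinuousAt (BetaExpansion.betaMap β) x := by
  rw [ContinuousAt, tendsto_subtype_rng]
  have h : Int.fract (β * (x : ℝ)) ≠ 0 := fun h => hx (Subtype.ext h)
  have hc : ContinuousAt (Int.fract : ℝ → ℝ) (β * (x : ℝ)) :=
    continuousAt_fract fun h' => h (sub_eq_zero.2 h')
  exact ContinuousAt.comp (f := fun x : unitInterval => β * (x : ℝ)) hc (by fun_prop)

theorem continuousAt_betaMap_iterate {x : unitInterval} (hx : x ∉ zeroOrbit β) (n : ℕ) :
    ContinuousAt (BetaExpansion.betaMap β)^[n] x := by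
  induction n with
  | zero => exact continuousAt_id
  | succ n ih =>
    rw [Function.iterate_succ']
    refine ContinuousAt.comp (continuousAt_betaMap fun h => hx ?_) ih
    rw [← Function.iterate_succ_apply' (BetaExpansion.betaMap β)] at h
    exact mem_iUnion.2 ⟨n + 1, h⟩

theorem cast_betaDigit (hβ : 1 < β) (x : unitInterval) (i : ℕ) :
    (BetaExpansion.betaDigit β x i : ℝ) = β * ((BetaExpansion.betaMap β)^[i] x : unitInterval)
      - ((BetaExpansion.betaMap β)^[i + 1] x : unitInterval) := by
  have h : 0 ≤ β * (((BetaExpansion.betaMap β)^[i] x : unitInterval) : ℝ) :=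
    mul_nonneg (by positivity) ((BetaExpansion.betaMap β)^[i] x).2.1
  rw [BetaExpansion.betaDigit, natCast_floor_eq_intCast_floor h, Function.iterate_succ_apply']
  exact (Int.self_sub_fract _).symm

/-- A digit is an integer-valued combination of two iterates that are continuous at `x`. -/
theorem eventually_betaDigit_eq (hβ : 1 < β) {x : unitInterval} (hx : x ∉ zeroOrbit β) (i : ℕ) :
    ∀ᶠ x' in 𝓝 x, BetaExpansion.betaDigit β x' i = BetaExpansion.betaDigit β x i := by
  have h : ContinuousAt (fun x' => (BetaExpansion.betaDigit β x' i : ℝ)) x := by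
    simp only [cast_betaDigit hβ]
    exact (((continuous_subtype_val.continuousAt).comp
      (continuousAt_betaMap_iterate hx i)).const_mul β).sub
      ((continuous_subtype_val.continuousAt).comp (continuousAt_betaMap_iterate hx (i + 1)))
  filter_upwards [Metric.tendsto_nhds.1 h 1 one_pos] with x' hx'
  rw [Real.dist_eq] at hx'
  have : |((BetaExpansion.betaDigit β x' i : ℤ) - BetaExpansion.betaDigit β x i)| < 1 := by
    exact_mod_cast hx'
  rw [Int.abs_lt_one_iff] at this
  omega

theorem isPi_three_setOf_generates (hβ : 1 < β) (μ : Measure unitInterval)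
    [IsProbabilityMeasure μ] :
    BetaExpansion.IsPi 3 {x | BetaExpansion.Generates (BetaExpansion.betaMap β) μ x} := by
  let f : ℕ → ℕ → unitInterval → ℝ := fun k N x =>
    (∑ n ∈ Finset.range N, (((BetaExpansion.betaMap β)^[n] x : unitInterval) : ℝ) ^ k) / N
  let U : ℕ × ℕ → ℕ → ℕ → Set unitInterval := fun p M N =>
    {x | M ≤ N ∧ 1 / ((p.2 : ℝ) + 1) < dist (f p.1 N x) (∫ x : unitInterval, (x : ℝ) ^ p.1 ∂μ)}
  have hU : ∀ p M N, ∀ x ∉ zeroOrbit β, x ∈ U p M N → U p M N ∈ 𝓝 x := by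
    rintro p M N x hx ⟨hMN, hlt⟩
    have hf : ContinuousAt (f p.1 N) x := by
      refine ContinuousAt.div_const (tendsto_finsetSum _ fun n _ => ?_) _
      exact ((continuous_subtype_val.continuousAt).comp (continuousAt_betaMap_iterate hx n)).pow _
    filter_upwards [(hf.dist continuousAt_const).eventually (lt_mem_nhds hlt)] with x' hx'
    exact ⟨hMN, hx'⟩
  have h := isSigma_three_setOf (countable_zeroOrbit hβ) U hU
  rw [BetaExpansion.IsPi]
  convert! h using 1
  ext x
  simp only [mem_compl_iff, mem_ofPred_eq, generates_iff_moments, Metric.tendsto_atTop, U,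
    Prod.exists]
  push Not
  refine exists_congr fun k => ⟨?_, ?_⟩
  · rintro ⟨ε, hε, h⟩
    obtain ⟨p, hp⟩ := exists_nat_one_div_lt hε
    exact ⟨p, fun M => (h M).imp fun N hN => ⟨hN.1, hp.trans_le hN.2⟩⟩
  · rintro ⟨p, h⟩
    exact ⟨1 / ((p : ℝ) + 1), by positivity, fun M => (h M).imp fun N hN => ⟨hN.1, hN.2.le⟩⟩

/-- The Cauchy criterion expresses divergence without quantifying over candidate limits; block
frequencies up to `N` are locally constant off `zeroOrbit β`. -/
theorem isSigma_three_setOf_isIrregular (hβ : 1 < β) :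
    BetaExpansion.IsSigma 3
      {x : unitInterval | BetaExpansion.IsIrregular (BetaExpansion.betaDigit β x)} := by
  let f : (w : Σ k, Fin k → ℕ) → ℕ → unitInterval → ℝ := fun w N x =>
    (∑ n ∈ Finset.range N, (BetaExpansion.occurrences (BetaExpansion.betaDigit β x) w.2).indicator
      (fun _ => (1 : ℝ)) n) / N
  let U : (Σ k, Fin k → ℕ) × ℕ → ℕ → ℕ × ℕ → Set unitInterval := fun p M N =>
    {x | 1 ≤ p.1.1 ∧ M ≤ N.1 ∧ M ≤ N.2 ∧
      1 / ((p.2 : ℝ) + 1) < dist (f p.1 N.1 x) (f p.1 N.2 x)}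
  have hf : ∀ w N, ∀ x ∉ zeroOrbit β, ContinuousAt (f w N) x := by
    intro w N x hx
    have hev : ∀ᶠ x' in 𝓝 x, ∀ i ∈ Finset.range (N + w.1),
        BetaExpansion.betaDigit β x' i = BetaExpansion.betaDigit β x i :=
      (Filter.eventually_all_finset _).2 fun i _ => eventually_betaDigit_eq hβ hx i
    refine ContinuousAt.congr (f := fun _ => f w N x) continuousAt_const ?_
    filter_upwards [hev] with x' hx'
    simp only [f]
    congr 1
    refine Finset.sum_congr rfl fun n hn => ?_
    have hiff : n ∈ BetaExpansion.occurrences (BetaExpansion.betaDigit β x) w.2 ↔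
        n ∈ BetaExpansion.occurrences (BetaExpansion.betaDigit β x') w.2 := by
      refine forall_congr' fun i => ?_
      have := Finset.mem_range.1 hn
      rw [hx' (n + i) (Finset.mem_range.2 (by omega))]
    by_cases hm : n ∈ BetaExpansion.occurrences (BetaExpansion.betaDigit β x) w.2
    · rw [indicator_of_mem hm, indicator_of_mem (hiff.1 hm)]
    · rw [indicator_of_notMem hm, indicator_of_notMem (mt hiff.2 hm)]
  have hU : ∀ p M N, ∀ x ∉ zeroOrbit β, x ∈ U p M N → U p M N ∈ 𝓝 x := by
    rintro p M N x hx ⟨h1, h2, h3, hlt⟩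
    filter_upwards [((hf p.1 N.1 x hx).dist (hf p.1 N.2 x hx)).eventually (lt_mem_nhds hlt)]
      with x' hx'
    exact ⟨h1, h2, h3, hx'⟩
  have : Nonempty ((Σ k, Fin k → ℕ) × ℕ) := ⟨(⟨0, Fin.elim0⟩, 0)⟩
  convert! isSigma_three_setOf (countable_zeroOrbit hβ) U hU using 1
  ext x
  simp only [mem_ofPred_eq, U, Prod.exists, BetaExpansion.IsIrregular, Sigma.exists]
  refine exists_congr fun k => exists_congr fun w => ?_
  have hcau : (∃ a, BetaExpansion.HasFrequency
      (BetaExpansion.occurrences (BetaExpansion.betaDigit β x) w) a) ↔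
      CauchySeq fun N => f ⟨k, w⟩ N x := by
    simp only [hasFrequency_iff]
    exact ⟨fun ⟨a, ha⟩ => ha.cauchySeq, cauchySeq_tendsto_of_complete⟩
  rw [hcau, Metric.cauchySeq_iff]
  push Not
  constructor
  · rintro ⟨hk, ε, hε, h⟩
    obtain ⟨p, hp⟩ := exists_nat_one_div_lt hε
    refine ⟨p, fun M => ?_⟩
    obtain ⟨m, hm, n, hn, hmn⟩ := h M
    exact ⟨m, n, hk, hm, hn, hp.trans_le hmn⟩
  · rintro ⟨p, h⟩
    obtain ⟨-, -, hk, -⟩ := h 0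
    refine ⟨hk, 1 / ((p : ℝ) + 1), by positivity, fun M => ?_⟩
    obtain ⟨m, n, -, hm, hn, hmn⟩ := h M
    exact ⟨m, hm, n, hn, hmn.le⟩

end UpperBound

/-! ### Regular expansions and the Dirac mass at 0 -/

section Regular

variable {β : ℝ}

theorem fractMap_iterate_of_lt (hβ : 1 < β) {t : ℝ} (ht : 0 ≤ t) {k : ℕ} (h : β ^ k * t < 1) :
    ∀ i ≤ k, (fractMap β)^[i] t = β ^ i * t := by
  intro i
  induction i with
  | zero => simp
  | succ i ih =>
    intro hi
    rw [Function.iterate_succ_apply', ih (by omega)]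
    refine fractMap_of_eq_add 0 ?_ (by positivity) (lt_of_le_of_lt ?_ h)
    · rw [pow_succ]; push_cast; ring
    · gcongr
      exact hβ.le

theorem betaDigit_eq_zero (hβ : 1 < β) {x : unitInterval} {l k : ℕ}
    (h : β ^ k * ((BetaExpansion.betaMap β)^[l] x : unitInterval) < 1) {i : ℕ} (hi : i < k) :
    BetaExpansion.betaDigit β x (l + i) = 0 := by
  have h0 := ((BetaExpansion.betaMap β)^[l] x).2.1
  rw [BetaExpansion.betaDigit, add_comm l i, Function.iterate_add_apply, coe_betaMap_iterate,
    fractMap_iterate_of_lt hβ h0 h i hi.le, Nat.floor_eq_zero, ← mul_assoc, ← pow_succ']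
  refine lt_of_le_of_lt ?_ h
  gcongr
  · exact hβ.le
  · exact hi

theorem measurePreserving_dirac_zero (β : ℝ) :
    MeasurePreserving (BetaExpansion.betaMap β) (Measure.dirac (0 : unitInterval))
      (Measure.dirac 0) := by
  have hm : Measurable (BetaExpansion.betaMap β) :=
    Measurable.subtype_mk (measurable_fract.comp (measurable_subtype_coe.const_mul β))
  refine ⟨hm, ?_⟩
  rw [Measure.map_dirac' hm]
  congr 1
  exact Subtype.ext (by simp [BetaExpansion.betaMap])

theorem hasFrequency_one_of_subset {E S : Set ℕ} (hE : BetaExpansion.HasFrequency E 1) (h : E ⊆ S) :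
    BetaExpansion.HasFrequency S 1 := by
  rw [hasFrequency_iff] at *
  refine tendsto_of_tendsto_of_tendsto_of_le_of_le hE tendsto_const_nhds (fun N => ?_)
    fun N => ?_
  · dsimp only
    gcongr with n
  · refine div_le_one_of_le₀ ?_ (Nat.cast_nonneg N)
    refine (Finset.sum_le_card_nsmul _ _ 1 fun n _ => indicator_le_self' (by simp) n).trans_eq ?_
    simp

theorem hasFrequency_zero_of_disjoint {E S : Set ℕ} (hE : BetaExpansion.HasFrequency E 1)
    (h : Disjoint E S) : BetaExpansion.HasFrequency S 0 := by
  rw [hasFrequency_iff] at *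
  have h1 := (tendsto_const_nhds (x := (1 : ℝ)) (f := atTop)).sub hE
  rw [sub_self] at h1
  refine tendsto_of_tendsto_of_tendsto_of_le_of_le' tendsto_const_nhds h1
    (Eventually.of_forall fun N => ?_) ?_
  · exact div_nonneg (Finset.sum_nonneg fun n _ => indicator_nonneg (by simp) n)
      (Nat.cast_nonneg N)
  · filter_upwards [eventually_gt_atTop 0] with N hN
    have hN' : (0 : ℝ) < N := by exact_mod_cast hN
    rw [le_sub_iff_add_le, ← add_div, div_le_one hN', ← Finset.sum_add_distrib]
    refine (Finset.sum_le_card_nsmul _ _ 1 fun n _ => ?_).trans_eq (by simp)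
    by_cases hn : n ∈ S
    · rw [indicator_of_mem hn, indicator_of_notMem (disjoint_right.1 h hn), add_zero]
    · rw [indicator_of_notMem hn, zero_add]
      exact indicator_le_self' (by simp) n

/-- The orbit lies below `β⁻ᵏ` with frequency 1, and each such visit starts `k` zero digits. So a
zero block has frequency 1 and any other block frequency 0. -/
theorem not_isIrregular_of_generates_dirac_zero (hβ : 1 < β) {x : unitInterval}
    (hx : BetaExpansion.Generates (BetaExpansion.betaMap β) (Measure.dirac 0) x) :
    ¬ BetaExpansion.IsIrregular (BetaExpansion.betaDigit β x) := by
  rintro ⟨k, w, -, hw⟩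
  apply hw
  let J : Set unitInterval := {y | β ^ k * (y : ℝ) < 1}
  have hJo : IsOpen J := isOpen_lt (by fun_prop) continuous_const
  have h0 : (0 : unitInterval) ∈ J := by simp [J]
  have hJ : J.OrdConnected := ordConnected_of_Ioo fun a _ b hb _ c hc => by
    refine lt_of_le_of_lt ?_ (show β ^ k * (b : ℝ) < 1 from hb)
    have : (c : ℝ) ≤ b := hc.2.le
    gcongr
  have hf : (Measure.dirac (0 : unitInterval)) (frontier J) = 0 := by
    rw [Measure.dirac_apply' _ isClosed_frontier.measurableSet, indicator_of_notMem]
    rw [hJo.frontier_eq]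
    exact fun h => h.2 h0
  have hfreq := hx J hJ hf
  rw [Measure.dirac_apply' _ hJo.measurableSet, indicator_of_mem h0] at hfreq
  simp only [Pi.one_apply, ENNReal.toReal_one] at hfreq
  by_cases hw0 : ∀ i, w i = 0
  · refine ⟨1, hasFrequency_one_of_subset hfreq fun l hl i => ?_⟩
    rw [hw0, betaDigit_eq_zero hβ hl i.2]
  · push Not at hw0
    obtain ⟨i, hi⟩ := hw0
    refine ⟨0, hasFrequency_zero_of_disjoint hfreq (disjoint_left.2 fun l hl hl' => hi ?_)⟩
    rw [← hl' i, betaDigit_eq_zero hβ hl i.2]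

/-- Blocks of length 1 give the mean of the bounded digits. As `dₙ = β Tⁿx - Tⁿ⁺¹x`, summing
telescopes to `β - 1` times the orbit sum, up to a bounded term. -/
theorem exists_tendsto_average_of_not_isIrregular (hβ : 1 < β) {x : unitInterval}
    (hx : ¬ BetaExpansion.IsIrregular (BetaExpansion.betaDigit β x)) :
    ∃ c : ℝ, Tendsto (fun N : ℕ => (∑ n ∈ Finset.range N,
      (((BetaExpansion.betaMap β)^[n] x : unitInterval) : ℝ) ^ 1) / N) atTop (𝓝 c) := by
  have hβ1 : β - 1 ≠ 0 := by linarith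
  set d := BetaExpansion.betaDigit β x with hd
  have hfr : ∀ a : ℕ, ∃ c, BetaExpansion.HasFrequency {n | d n = a} c := by
    intro a
    by_contra h
    refine hx ⟨1, fun _ => a, le_rfl, ?_⟩
    have : BetaExpansion.occurrences d (fun _ : Fin 1 => a) = {n | d n = a} := by
      ext n; simp [BetaExpansion.occurrences]
    rwa [this]
  choose F hF using hfr
  have hle : ∀ n, d n ≤ ⌊β⌋₊ := fun n => Nat.floor_le_floor
    (mul_le_of_le_one_right (by positivity) ((BetaExpansion.betaMap β)^[n] x).2.2)
  have hdig : Tendsto (fun N : ℕ => (∑ n ∈ Finset.range N, (d n : ℝ)) / N) atTop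
      (𝓝 (∑ a ∈ Finset.range (⌊β⌋₊ + 1), (a : ℝ) * F a)) := by
    have h := tendsto_finsetSum (Finset.range (⌊β⌋₊ + 1)) fun a _ =>
      ((hasFrequency_iff _ _).1 (hF a)).const_mul (a : ℝ)
    refine h.congr fun N => ?_
    simp only [← mul_div_assoc]
    rw [← Finset.sum_div]
    simp only [Finset.mul_sum]
    rw [Finset.sum_comm]
    congr 1
    refine Finset.sum_congr rfl fun n _ => ?_
    rw [Finset.sum_eq_single (d n)]
    · simp
    · intro a _ ha
      rw [indicator_of_notMem (show n ∉ {n | d n = a} from fun h => ha (Eq.symm h)), mul_zero]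
    · intro h
      exact absurd (Finset.mem_range.2 (Nat.lt_succ_of_le (hle n))) h
  have hsum : ∀ N : ℕ, (β - 1) * ∑ n ∈ Finset.range N,
      (((BetaExpansion.betaMap β)^[n] x : unitInterval) : ℝ) = ∑ n ∈ Finset.range N, (d n : ℝ)
        + (((BetaExpansion.betaMap β)^[N] x : unitInterval) - (x : ℝ)) := by
    intro N
    induction N with
    | zero => simp
    | succ N ih =>
      rw [Finset.sum_range_succ, Finset.sum_range_succ, mul_add, ih, hd, cast_betaDigit hβ]
      ring
  have hbd : Tendsto (fun N : ℕ => ((((BetaExpansion.betaMap β)^[N] x : unitInterval) : ℝ)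
      - (x : ℝ)) / N) atTop (𝓝 0) := by
    refine tendsto_bdd_div_atTop_nhds_zero (b := -1) (B := 1) ?_ ?_ tendsto_natCast_atTop_atTop
    · exact Eventually.of_forall fun N => by
        linarith [((BetaExpansion.betaMap β)^[N] x).2.1, x.2.2]
    · exact Eventually.of_forall fun N => by
        linarith [((BetaExpansion.betaMap β)^[N] x).2.2, x.2.1]
  refine ⟨_, ((hdig.add hbd).div_const (β - 1)).congr fun N => ?_⟩
  rw [← add_div, ← hsum]
  simp only [pow_one]
  field_simp

end Regular

theorem mainTheorem6 (β : ℝ) (hβ : 1 < β) :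
    (∀ μ : MeasureTheory.Measure unitInterval, MeasureTheory.IsProbabilityMeasure μ →
      MeasureTheory.MeasurePreserving (BetaExpansion.betaMap β) μ μ →
        BetaExpansion.IsPiComplete 3
          {x : unitInterval | BetaExpansion.Generates (BetaExpansion.betaMap β) μ x}) ∧
    BetaExpansion.IsSigmaComplete 3
      {x : unitInterval | BetaExpansion.IsIrregular (BetaExpansion.betaDigit β x)} := by
  refine ⟨fun μ hμ hT => ⟨isPi_three_setOf_generates hβ μ, fun hS => ?_⟩,
    isSigma_three_setOf_isIrregular hβ, fun hS => ?_⟩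
  · obtain ⟨g, hg, h⟩ := exists_continuous_reduction hβ hT
    refine not_isSigma_three_tendsto_atTop ?_
    convert! isSigma_three_preimage hS hg using 1
    ext α
    rw [mem_preimage, mem_ofPred_eq, mem_ofPred_eq, generates_iff_moments]
    exact ⟨(h α).1, fun hα => (h α).2 _ (hα 1)⟩
  -- For `δ₀`, the preimage under `g` of the regular points is exactly the set of sequences tending
  -- to infinity.
  · obtain ⟨g, hg, h⟩ := exists_continuous_reduction hβ (measurePreserving_dirac_zero β)
    refine not_isSigma_three_tendsto_atTop ?_
    convert! isSigma_three_preimage hS hg using 1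
    ext α
    rw [mem_preimage, mem_compl_iff, mem_ofPred_eq, mem_ofPred_eq]
    refine ⟨fun hα => not_isIrregular_of_generates_dirac_zero hβ
      ((generates_iff_moments _ _ _).2 ((h α).1 hα)), fun hα => ?_⟩
    obtain ⟨c, hc⟩ := exists_tendsto_average_of_not_isIrregular hβ hα
    exact (h α).2 c hc
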